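/- **Notation.** Write $e(z)=e^{2\pi i z}$, $q^x=e(x\tau)$, $\zeta^x=e(x)$ for $x\in\mathbb{Q}$. Let $V=\mathbb{Q}^2$ (row vectors). For $U\subset V$ let $[U]$ be its characteristic function. Let $\mathcal{S}(V')$ be the group of functions $f:V\to\mathbb{Z}$ that are invariant under some lattice, supported in some lattice, and satisfy $f(0)=0$. Matrices act by $(f\mid\gamma)(v)=f(v\gamma^{-1})$. * The theta-unit distribution $u$ is the $\mathbb{Q}^\times$-invariant multiplicative distribution on $\mathcal{S}(V')$ whose value on $[(x_1,x_2)+\mathbb{Z}^2]$ is the function on the upper half plane $$\prod_{y\in x_1+\mathbb{Z},\ y>0}(1-q^{y}\zeta^{x_2})\ \prod_{y\in x_1+\mathbb{Z},\ y<0}(1-q^{-y}\zeta^{-x_2}).$$ * $\delta_0\otimes\mathrm{RClog}$ is the $\mathbb{Q}^\times$-invariant real-valued distribution on $\mathcal{S}(V')$ whose value on $[(x_1,x_2)+\mathbb{Z}^2]$ is $\log|1-e(x_2)|$ if $x_1\in\mathbb{Z}$, and $0$ otherwise. * $\mathbb{B}_1(x)=0$ for $x\in\mathbb{Z}$ and $\mathbb{B}_1(x)=x-\lfloor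 x\rfloor-\tfrac12$ for $x\in\mathbb{Q}\setminus\mathbb{Z}$. For $\alpha\in\mathbb{Z}$, $\beta\in\mathbb{Z}_{>0}$ and $a,b\in\mathbb{Q}$, $$C(\alpha,\beta,a,b)=\sum_{\ell=0}^{\beta-1}\mathbb{B}_1\!\left(\frac{a+\ell}{\beta}\right)\mathbb{B}_1\!\left(b+\frac{\alpha}{\beta}(a+\ell)\right).$$ * For $r\in\mathbb{Q}$ and a function $F$ on the upper half plane, $\int_r^{i\infty}F(\tau)\,d\tau$ denotes the regularized integral along $\tau=r+it$, $t>0$: the integral $\int_0^\infty iF(r+it)\,t^{s-1}\,dt$ converges absolutely for $\mathrm{Re}(s)>2$, extends to a holomorphic function of $s\in\mathbb{C}\setminus\{0,2\}$, and the value of this extension at $s=1$ is the regularized integral. Here $\mathrm{dlog}\,h=\frac{h'(\tau)}{h(\tau)}\,d\tau$. **Theorem.** Let $a,b\in\mathbb{Q}$, not both integers, and let $f=[(a,b)+\mathbb{Z}^2]\in\mathcal{S}(V')$. Let $\gamma\in\mathrm{SL}_2(\mathbb{Z})$ with $\gamma\cdot i\infty=\alpha/\beta$, where $\alpha,\beta$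 are coprime integers and $\beta>0$. Then the regularized integral of $\mathrm{dlog}\,(u(f))$ from $\gamma i\infty$ to $i\infty$ exists and $$\frac{1}{2\pi i}\int_{\gamma i\infty}^{i\infty}\mathrm{dlog}\,(u(f))=C(\alpha,\beta,a,b)-\frac{1}{2\pi i}(\delta_0\otimes\mathrm{RClog})(f\mid\gamma-f).$$ **Corollary.** Let moreover $D$ be a positive integer with $\gamma\in\Gamma_0(D)$, and put $UL(D)=\begin{pmatrix}D&0\\0&1\end{pmatrix}$. Then $\gamma_D:=UL(D)\,\gamma\,UL(D)^{-1}$ lies in $\mathrm{SL}_2(\mathbb{Z})$, the regularized integral of $\mathrm{dlog}\,(u(f)(D\tau))$ from $\alpha/\beta$ to $i\infty$ exists, and $$\frac{1}{2\pi i}\int_{\alpha/\beta}^{i\infty}\mathrm{dlog}\,(u(f)(D\tau))=C(\alpha,\beta/D,a,b)-\frac{1}{2\pi i}(\delta_0\otimes\mathrm{RClog})(f\mid\gamma_D-f).$$ -/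

import Mathlib

open scoped MatrixGroups OnePoint

noncomputable section

namespace EisensteinPeriod

/-! ### Test functions on `V = ℚ²` (row vectors) -/

/-- The space `V = ℚ²`, regarded as row vectors. -/
abbrev V : Type := Fin 2 → ℚ

/-- `f` is invariant under translation by the lattice `n ℤ²`. -/
def IsInvariant (n : ℕ) (f : V → ℤ) : Prop :=
  ∀ (v : V) (k : Fin 2 → ℤ), f (v + fun i => (n : ℚ) * (k i : ℚ)) = f v

/-- `f ∈ 𝒮(V')`: `f` is invariant under some lattice, supported in some lattice, and supported
away from `0`. (Every lattice contains some `n ℤ²` and is contained in some `m⁻¹ ℤ²`.) -/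
structure IsTestFunctionAwayFromZero (f : V → ℤ) : Prop where
  invariant : ∃ n : ℕ, 0 < n ∧ IsInvariant n f
  bounded : ∃ m : ℕ, 0 < m ∧ ∀ v, f v ≠ 0 → ∀ i, ∃ k : ℤ, (m : ℚ) * v i = k
  away : f 0 = 0

open Classical in
/-- The characteristic function `[(a,b) + ℤ²]`. -/
def coset (a b : ℚ) : V → ℤ := fun v =>
  if (∃ k : ℤ, v 0 = a + k) ∧ (∃ k : ℤ, v 1 = b + k) then 1 else 0

/-- The right action `(f ∣ g)(v) = f(v g⁻¹)` on functions on row vectors. -/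
def slash (f : V → ℤ) (g : Matrix (Fin 2) (Fin 2) ℚ) : V → ℤ :=
  fun v => f (Matrix.vecMul v g⁻¹)

/-- An element of `SL₂(ℤ)` as a rational matrix. -/
def toRat (γ : SL(2, ℤ)) : Matrix (Fin 2) (Fin 2) ℚ := γ.1.map (fun n : ℤ => (n : ℚ))

/-- The diagonal matrix `UL(x)` with entries `x, 1`. -/
def UL (x : ℚ) : Matrix (Fin 2) (Fin 2) ℚ := !![x, 0; 0, 1]

/-! ### Distributions prescribed on the cosets of `ℤ²`

A `ℚˣ`-invariant distribution `μ` on `V` with values in an abelian group with trivial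
`ℚˣ`-action is determined by `σ(v) = μ([v + ℤ²])`: if `f` is invariant under `n ℤ²`, then
`v ↦ f(n v)` is `ℤ²`-invariant and `μ(f) = ∑_{v ∈ V/ℤ²} f(n v) σ(v)`. -/

/-- The least positive `n` such that `f` is invariant under `n ℤ²`. -/
def level (f : V → ℤ) : ℕ := sInf {n : ℕ | 0 < n ∧ IsInvariant n f}

/-- Representatives of `V/ℤ²`. -/
def unitSquare : Set V := {v | ∀ i, 0 ≤ v i ∧ v i < 1}

/-- The `ℚˣ`-invariant additive distribution with value `σ v` at `[v + ℤ²]`. -/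
def sumDist (σ : V → ℝ) (f : V → ℤ) : ℝ :=
  ∑ᶠ v ∈ unitSquare, (f fun i => (level f : ℚ) * v i) * σ v

/-- The `ℚˣ`-invariant multiplicative distribution with value `σ v` at `[v + ℤ²]`. -/
def prodDist (σ : V → ℂ) (f : V → ℤ) : ℂ :=
  ∏ᶠ v ∈ unitSquare, σ v ^ (f fun i => (level f : ℚ) * v i)

/-- `e(z) = exp(2πiz)`; thus `q^x = e(xτ)` and `ζ^x = e(x)`. -/
def e (z : ℂ) : ℂ := Complex.exp (2 * Real.pi * Complex.I * z)

open Classical in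
/-- The value `δ₀([a + ℤ])` of the rank one Dirac distribution. -/
def diracCoset (a : ℚ) : ℝ := if ∃ k : ℤ, a = k then 1 else 0

/-- The value `RClog([b + ℤ]) = log |1 - e(b)|`, for `b` not an integer. -/
def rclogCoset (b : ℚ) : ℝ := Real.log ‖1 - e b‖

/-- The distribution `δ₀ ⊗ RClog` on test functions supported away from `0`. Its value at
`[(a,b) + ℤ²] = [(a + ℤ) × (b + ℤ)]` is `δ₀([a + ℤ]) · RClog([b + ℤ])`. -/
def diracTensorRClog (f : V → ℤ) : ℝ :=
  sumDist (fun v => diracCoset (v 0) * rclogCoset (v 1)) f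

/-- The product
`∏_{y ∈ (a+ℤ), y > 0} (1 - q^y ζ^b) · ∏_{y ∈ (a+ℤ), y < 0} (1 - q^(-y) ζ^(-b))`. -/
def thetaUnitCoset (a b : ℚ) (τ : ℂ) : ℂ :=
  (∏' y : {y : ℚ // 0 < y ∧ ∃ k : ℤ, y = a + k}, (1 - e ((y : ℚ) * τ) * e b)) *
  (∏' y : {y : ℚ // y < 0 ∧ ∃ k : ℤ, y = a + k}, (1 - e (-(y : ℚ) * τ) * e (-b)))

/-- The theta-unit distribution `u(f)`, a function of `τ` in the upper half plane. -/
def thetaUnit (f : V → ℤ) (τ : ℂ) : ℂ :=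
  prodDist (fun v => thetaUnitCoset (v 0) (v 1) τ) f

/-! ### Dedekind sums -/

open Classical in
/-- The periodified Bernoulli polynomial `𝔹_r`. -/
def perBernoulli (r : ℕ) (x : ℚ) : ℚ :=
  if r = 1 ∧ ∃ k : ℤ, x = k then 0 else (Polynomial.bernoulli r).eval (Int.fract x)

/-- `C(α, β, a, b) = ∑_{ℓ=0}^{β-1} 𝔹₁((a+ℓ)/β) 𝔹₁(b + α(a+ℓ)/β)`. -/
def dedekindC (α : ℤ) (β : ℕ) (a b : ℚ) : ℚ :=
  ∑ ℓ ∈ Finset.range β,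
    perBernoulli 1 ((a + ℓ) / β) * perBernoulli 1 (b + (α : ℚ) / β * (a + ℓ))

/-! ### Regularized integrals from a cusp to `i∞` -/

/-- `P` is the regularized value of `∫_r^{i∞} F(τ) dτ` along the vertical path `τ = r + it`:
the integral `∫_r^{i∞} F(τ) Im(τ)^(s-1) dτ = ∫_0^∞ i F(r + it) t^(s-1) dt` converges absolutely
for `Re s > 2`, continues to a holomorphic function of `s ∈ ℂ ∖ {0, 2}`, and the value of this
continuation at `s = 1` is `P`. -/
def HasRegularizedPeriod (F : ℂ → ℂ) (r : ℚ) (P : ℂ) : Prop :=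
  ∃ M : ℂ → ℂ, DifferentiableOn ℂ M {0, 2}ᶜ ∧
    (∀ s : ℂ, 2 < s.re →
      MellinConvergent (fun t : ℝ => Complex.I * F (r + Complex.I * t)) s ∧
      M s = mellin (fun t : ℝ => Complex.I * F (r + Complex.I * t)) s) ∧
    M 1 = P

/-- The regularized value is unique. -/
theorem HasRegularizedPeriod.unique {F : ℂ → ℂ} {r : ℚ} {P Q : ℂ}
    (hP : HasRegularizedPeriod F r P) (hQ : HasRegularizedPeriod F r Q) : P = Q := by
  obtain ⟨M, hM, hM', rfl⟩ := hP
  obtain ⟨N, hN, hN', rfl⟩ := hQ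
  have hfin : ({0, 2} : Set ℂ).Finite := Set.toFinite _
  have hopen : IsOpen ({0, 2}ᶜ : Set ℂ) := hfin.isClosed.isOpen_compl
  have hconn : IsPreconnected ({0, 2}ᶜ : Set ℂ) :=
    (hfin.countable.isConnected_compl_of_one_lt_rank
      (by rw [Complex.rank_real_complex]; exact Nat.one_lt_ofNat)).isPreconnected
  have h3 : (3 : ℂ) ∈ ({0, 2}ᶜ : Set ℂ) := by norm_num
  have h1 : (1 : ℂ) ∈ ({0, 2}ᶜ : Set ℂ) := by norm_num
  refine (hM.analyticOnNhd hopen).eqOn_of_preconnected_of_eventuallyEq (hN.analyticOnNhd hopen)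
    hconn h3 ?_ h1
  have hU : IsOpen {s : ℂ | 2 < s.re} := isOpen_lt continuous_const Complex.continuous_re
  filter_upwards [hU.mem_nhds (by norm_num : (3 : ℂ) ∈ {s : ℂ | 2 < s.re})] with s hs
  rw [(hM' s hs).2, (hN' s hs).2]

end EisensteinPeriod

end

noncomputable section

open Filter Topology Set MeasureTheory Asymptotics

namespace EisensteinPeriod

/-! The theta unit of a coset is a product over `k ∈ ℤ` of factors `1 - c_k q^{|k+a|}` with `c_k =
e(±b)`, the sign being that of `k + a`. Expanding its logarithmic derivative in geometric series and
taking the Mellin transform along `τ = r + it` gives, for `Re s > 2`, a double series over `k` and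
`n ≥ 1` with terms `e(±n(b + (k+a)r)) |k+a|^{1-s} n^{-s}`, up to `-i Γ(s) (2π)^{-s}`
(`hasMellin_logDeriv`).

For `r = α/β` the phase depends only on `k` mod `β`. The class of `l` contributes Hurwitz zeta
functions in `x = (a+l)/β` at `s - 1` times periodic zeta functions in `y = b + α(a+l)/β` at `s`:
even with cosine, odd with sine (`hasSum_residueClass`). In completed form (`mellinPart_eq`) the
odd-sine product is entire. The even-cosine product carries a factor `s - 1`, which cancels the
possible simple pole at `s = 1`; since `(a,b)` is not integral, `x` and `y` are never both `0` mod
`1`, so there is no double pole. Only `0` and `2` remain singular.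

At `s = 1` the odd-sine product is `𝔹₁(x) 𝔹₁(y)`, by the functional equation and the imaginary part
of `-log(1 - e(x))`; summing over `l` gives the Dedekind sum. The even-cosine product survives only
if `x` or `y` is integral and yields `log|1 - e(·)|` at the other argument. At most one `l` has `x`
integral and at most one has `y` integral; these give `δ₀ ⊗ RClog` at `f` and at `f ∣ γ`
(`sum_fst_isInt`, `sum_snd_isInt`). The corollary is the theorem for `γ_D` after the rescaling `τ ↦
Dτ`, which does not change the value at `s = 1`. -/

/-! ### Absolute convergence of Mellin transforms of exponential series -/

/-- An integrable sum: a pointwise sum of functions with summable `L¹` norms is integrable. -/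
theorem integrable_of_hasSum {X ι : Type*} [MeasurableSpace X] {μ : Measure X} [Countable ι]
    {F : ι → X → ℂ} {f : X → ℂ} (hF : ∀ i, Integrable (F i) μ)
    (hs : Summable fun i => ∫ x, ‖F i x‖ ∂μ) (h : ∀ᵐ x ∂μ, HasSum (fun i => F i x) (f x)) :
    Integrable f μ := by
  have hmeas : AEStronglyMeasurable f μ := by
    refine aestronglyMeasurable_of_tendsto_ae (u := (atTop : Filter (Finset ι)))
      (f := fun S x => ∑ i ∈ S, F i x) (fun S => ?_) h
    exact (integrable_finsetSum S fun i _ => hF i).aestronglyMeasurable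
  refine ⟨hmeas, ?_⟩
  have h1 : ∀ i, ∫⁻ x, ‖F i x‖ₑ ∂μ = ENNReal.ofReal (∫ x, ‖F i x‖ ∂μ) := fun i =>
    (ofReal_integral_norm_eq_lintegral_enorm (hF i)).symm
  have h2 : ∫⁻ x, ∑' i, ‖F i x‖ₑ ∂μ < ⊤ := by
    rw [lintegral_tsum fun i => (hF i).aestronglyMeasurable.enorm]
    simp_rw [h1]
    rw [← ENNReal.ofReal_tsum_of_nonneg (fun i => integral_nonneg fun _ => norm_nonneg _) hs]
    exact ENNReal.ofReal_lt_top
  refine lt_of_le_of_lt (lintegral_mono_ae ?_) h2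
  filter_upwards [h] with x hx
  rw [← hx.tsum_eq]
  exact enorm_tsum_le_tsum_enorm

/-- The Mellin integral of a convergent exponential series converges absolutely as soon as the
Dirichlet series does. -/
theorem mellinConvergent_of_hasSum_exp {ι : Type*} [Countable ι] {a : ι → ℂ} {p : ι → ℝ}
    {F : ℝ → ℂ} {s : ℂ} (hp : ∀ i, a i = 0 ∨ 0 < p i) (hs : 0 < s.re)
    (hF : ∀ t ∈ Ioi 0, HasSum (fun i ↦ a i * Real.exp (-p i * t)) (F t))
    (h_sum : Summable fun i ↦ ‖a i‖ / (p i) ^ s.re) : MellinConvergent F s := by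
  have hnorm : ∀ i, ∀ t ∈ Ioi (0 : ℝ), ‖(t : ℂ) ^ (s - 1) * (a i * Real.exp (-p i * t))‖
      = ‖a i‖ * (t ^ (s.re - 1) * Real.exp (-(p i * t))) := by
    intro i t ht
    rw [norm_mul, norm_mul, Complex.norm_real, Real.norm_eq_abs, Real.abs_exp,
      Complex.norm_cpow_eq_rpow_re_of_pos ht, Complex.sub_re, Complex.one_re, neg_mul]
    ring
  refine integrable_of_hasSum (ι := ι)
    (F := fun i (t : ℝ) => (t : ℂ) ^ (s - 1) * (a i * (Real.exp (-p i * t) : ℝ))) (fun i => ?_) ?_ ?_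
  · rcases hp i with hai | hpi
    · simp [hai]
    have hint : IntegrableOn (fun t : ℝ => t ^ (s.re - 1) * Real.exp (-(p i * t))) (Ioi 0) := by
      -- A non-integrable function has integral `0` by convention, whereas the Gamma integral is
      -- positive.
      by_contra hcon
      have h0 := Real.integral_rpow_mul_exp_neg_mul_Ioi hs hpi
      rw [integral_undef hcon] at h0
      have : 0 < (1 / p i) ^ s.re * Real.Gamma s.re :=
        mul_pos (Real.rpow_pos_of_pos (by positivity) _) (Real.Gamma_pos_of_pos hs)
      exact this.ne h0
    refine (integrable_norm_iff ?_).mp ?_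
    · refine ContinuousOn.aestronglyMeasurable (fun t ht => ?_) measurableSet_Ioi
      refine ContinuousAt.continuousWithinAt (ContinuousAt.mul ?_ (by fun_prop))
      exact Complex.continuousAt_ofReal_cpow_const _ _ (Or.inr (ne_of_gt ht))
    · exact IntegrableOn.congr_fun (Integrable.const_mul hint ‖a i‖)
        (fun t ht => (hnorm i t ht).symm) measurableSet_Ioi
  · refine (h_sum.mul_left (Real.Gamma s.re)).congr fun i => ?_
    rw [setIntegral_congr_fun measurableSet_Ioi (hnorm i), integral_const_mul]
    rcases hp i with hai | hpi
    · simp [hai]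
    rw [Real.integral_rpow_mul_exp_neg_mul_Ioi hs hpi, one_div, Real.inv_rpow hpi.le]
    ring
  · filter_upwards [ae_restrict_mem measurableSet_Ioi] with t ht
    exact (hF t ht).mul_left _

/-! ### The periodic zeta function at `s = 1` -/

/-- On the unit circle `z ≠ 1` forces `Re z < 1`, so the real part is positive. This keeps `log(1 -
z e^{-t})` on the principal branch for all `t ≥ 0`. -/
theorem one_sub_mul_mem_slitPlane {z : ℂ} (hz : ‖z‖ = 1) (hz1 : z ≠ 1) {r : ℝ} (hr : 0 ≤ r)
    (hr1 : r ≤ 1) : 1 - z * r ∈ Complex.slitPlane := by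
  left
  have hre : z.re < 1 := by
    refine lt_of_le_of_ne (hz ▸ Complex.re_le_norm z) fun h => hz1 ?_
    have h2 : z.re ^ 2 + z.im ^ 2 = 1 := by
      have := Complex.sq_norm z
      rw [hz, Complex.normSq_apply] at this
      nlinarith
    have him : z.im = 0 := by nlinarith
    exact Complex.ext (by simp [h]) (by simp [him])
  have : (1 - z * r).re = 1 - z.re * r := by simp
  rw [this]
  rcases hr.eq_or_lt with rfl | h0
  · simp
  · nlinarith

/-- The variable `r = e^{-t}` runs in the compact interval `[0,1]`, where `1 - zr` has no zero. -/
theorem exists_norm_geometric_le {z : ℂ} (hz : ‖z‖ = 1) (hz1 : z ≠ 1) :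
    ∃ C : ℝ, ∀ t : ℝ, 0 ≤ t →
      ‖z * (Real.exp (-t) : ℝ) / (1 - z * (Real.exp (-t) : ℝ))‖ ≤ C * Real.exp (-t) := by
  have hcont : ContinuousOn (fun r : ℝ => ‖(1 - z * r)⁻¹‖) (Icc 0 1) := by
    refine ContinuousOn.norm (ContinuousOn.inv₀ (by fun_prop) fun r hr => ?_)
    exact Complex.slitPlane_ne_zero (one_sub_mul_mem_slitPlane hz hz1 hr.1 hr.2)
  obtain ⟨C, hC⟩ := isCompact_Icc.bddAbove_image hcont
  refine ⟨C, fun t ht => ?_⟩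
  have hmem : Real.exp (-t) ∈ Icc (0 : ℝ) 1 :=
    ⟨(Real.exp_pos _).le, Real.exp_le_one_iff.2 (by linarith)⟩
  have := hC (mem_image_of_mem _ hmem)
  rw [div_eq_mul_inv, norm_mul, norm_mul, hz, one_mul, Complex.norm_real, Real.norm_eq_abs,
    Real.abs_exp, mul_comm]
  exact mul_le_mul_of_nonneg_right this (Real.exp_pos _).le

theorem continuousOn_geometric {z : ℂ} (hz : ‖z‖ = 1) (hz1 : z ≠ 1) :
    ContinuousOn (fun t : ℝ => z * (Real.exp (-t) : ℝ) / (1 - z * (Real.exp (-t) : ℝ)))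
      (Ioi 0) := by
  refine ContinuousOn.div (by fun_prop) (by fun_prop) fun t ht => ?_
  exact Complex.slitPlane_ne_zero (one_sub_mul_mem_slitPlane hz hz1 (Real.exp_pos _).le
    (Real.exp_le_one_iff.2 (neg_nonpos.2 (le_of_lt ht))))

/-- At `s = 1` the Mellin weight is `1` and the integrand is the derivative of `log(1 - z e^{-t})`.
-/
theorem mellin_geometric_one {z : ℂ} (hz : ‖z‖ = 1) (hz1 : z ≠ 1) :
    mellin (fun t : ℝ => z * (Real.exp (-t) : ℝ) / (1 - z * (Real.exp (-t) : ℝ))) 1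
      = -Complex.log (1 - z) := by
  have hslit : ∀ t : ℝ, 0 ≤ t → 1 - z * ((Real.exp (-t) : ℝ) : ℂ) ∈ Complex.slitPlane :=
    fun t ht =>
      one_sub_mul_mem_slitPlane hz hz1 (Real.exp_pos _).le (Real.exp_le_one_iff.2 (by linarith))
  obtain ⟨C, hC⟩ := exists_norm_geometric_le hz hz1
  have hint : IntegrableOn
      (fun t : ℝ => z * (Real.exp (-t) : ℝ) / (1 - z * (Real.exp (-t) : ℝ))) (Ioi 0) := by
    refine Integrable.mono' ((integrableOn_exp_neg_Ioi 0).const_mul C)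
      ((continuousOn_geometric hz hz1).aestronglyMeasurable measurableSet_Ioi) ?_
    filter_upwards [ae_restrict_mem measurableSet_Ioi] with t ht using hC t (le_of_lt ht)
  have hexp : ∀ t : ℝ, HasDerivAt (fun t : ℝ => ((Real.exp (-t) : ℝ) : ℂ))
      (-(Real.exp (-t) : ℝ) : ℂ) t := fun t => by
    have := ((hasDerivAt_neg t).exp).ofReal_comp
    simpa using this
  have hderiv : ∀ t ∈ Ici (0 : ℝ),
      HasDerivAt (fun t : ℝ => Complex.log (1 - z * (Real.exp (-t) : ℝ)))
        (z * (Real.exp (-t) : ℝ) / (1 - z * (Real.exp (-t) : ℝ))) t := fun t ht => by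
    have := ((hexp t).const_mul z |>.const_sub 1).clog_real (hslit t ht)
    simpa using this
  have hlim : Tendsto (fun t : ℝ => Complex.log (1 - z * (Real.exp (-t) : ℝ))) atTop (𝓝 0) := by
    have h1 : Tendsto (fun t : ℝ => 1 - z * ((Real.exp (-t) : ℝ) : ℂ)) atTop
        (𝓝 (1 - z * (0 : ℝ))) :=
      ((Complex.continuous_ofReal.tendsto 0).comp
        (Real.tendsto_exp_neg_atTop_nhds_zero)).const_mul z |>.const_sub 1
    have h2 := h1.clog (by simp)
    simpa using h2
  have := integral_Ioi_of_hasDerivAt_of_tendsto' hderiv hint hlim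
  simpa [mellin] using this

theorem norm_e_ofReal (x : ℝ) : ‖e x‖ = 1 := by
  rw [e, show (2 * Real.pi * Complex.I * x : ℂ) = ((2 * Real.pi * x : ℝ) : ℂ) * Complex.I by
    push_cast; ring]
  exact Complex.norm_exp_ofReal_mul_I _

theorem e_add (z w : ℂ) : e (z + w) = e z * e w := by
  rw [e, e, e, ← Complex.exp_add]; ring_nf

theorem e_neg (z : ℂ) : e (-z) = (e z)⁻¹ := by
  rw [e, e, ← Complex.exp_neg]; ring_nf

theorem e_int (n : ℤ) : e n = 1 :=
  Complex.exp_eq_one_iff.2 ⟨n, by ring⟩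

theorem e_nat_mul (n : ℕ) (z : ℂ) : e (n * z) = e z ^ n := by
  rw [e, e, ← Complex.exp_nat_mul]; ring_nf

theorem e_ofReal_eq_one_iff (x : ℝ) : e x = 1 ↔ (x : UnitAddCircle) = 0 := by
  rw [e, Complex.exp_eq_one_iff, AddCircle.coe_eq_zero_iff]
  refine exists_congr fun n => ?_
  have hpi : (2 * Real.pi * Complex.I : ℂ) ≠ 0 := Complex.two_pi_I_ne_zero
  rw [mul_comm (n : ℂ), mul_right_inj' hpi]
  simp only [zsmul_eq_mul, mul_one]
  constructor
  · intro h; exact_mod_cast h.symm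
  · intro h; exact_mod_cast h.symm

/-- The series is not absolutely convergent at `s = 1`. For `Re s > 1` the Mellin transform of the
geometric series is `Γ(s)` times the periodic zeta function; both sides are holomorphic on `Re s >
0`, so the identity theorem reaches `s = 1`. -/
theorem expZeta_one {x : ℝ} (hx : (x : UnitAddCircle) ≠ 0) :
    HurwitzZeta.expZeta x 1 = -Complex.log (1 - e x) := by
  have hz : ‖e x‖ = 1 := norm_e_ofReal x
  have hz1 : e x ≠ 1 := fun h => hx ((e_ofReal_eq_one_iff x).1 h)
  rw [← mellin_geometric_one hz hz1]
  set g : ℝ → ℂ := fun t => e x * (Real.exp (-t) : ℝ) / (1 - e x * (Real.exp (-t) : ℝ)) with hg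
  obtain ⟨C, hC⟩ := exists_norm_geometric_le hz hz1
  have hdiff : ∀ s : ℂ, 0 < s.re → DifferentiableAt ℂ (mellin g) s := fun s hs => by
    refine mellin_differentiableAt_of_isBigO_rpow_exp (a := 1) (b := 0) one_pos
      ((continuousOn_geometric hz hz1).locallyIntegrableOn measurableSet_Ioi) ?_ ?_ hs
    · refine IsBigO.of_bound C ?_
      filter_upwards [eventually_ge_atTop 0] with t ht
      simpa [hg] using hC t ht
    · refine IsBigO.of_bound |C| ?_
      filter_upwards [self_mem_nhdsWithin] with t ht
      have h1 : Real.exp (-t) ≤ 1 := Real.exp_le_one_iff.2 (neg_nonpos.2 (le_of_lt ht))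
      have h2 := hC t (le_of_lt ht)
      have h3 : C * Real.exp (-t) ≤ |C| * 1 :=
        mul_le_mul (le_abs_self C) h1 (Real.exp_pos _).le (abs_nonneg _)
      simpa [hg] using h2.trans h3
  have hseries : ∀ s : ℂ, 1 < s.re → mellin g s = Complex.Gamma s * HurwitzZeta.expZeta x s := by
    intro s hs
    have h1 := HurwitzZeta.hasSum_expZeta_of_one_lt_re x hs
    have hs0 : s ≠ 0 := fun h => by norm_num [h] at hs
    -- The term `n = 0` is zero because `0 ^ s = 0` and division by zero gives `0`.
    rw [← hasSum_nat_add_iff' 1] at h1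
    simp only [Finset.range_one, Finset.sum_singleton, Nat.cast_zero, Complex.zero_cpow hs0,
      div_zero, sub_zero] at h1
    have h2 := hasSum_mellin (a := fun n : ℕ => e x ^ (n + 1)) (p := fun n : ℕ => (n + 1 : ℝ))
      (F := g) (s := s) (fun n => Or.inr (by positivity)) (by linarith) (fun t ht => ?_) ?_
    · refine h2.unique ?_
      refine (h1.mul_left (Complex.Gamma s)).congr_fun fun n => ?_
      rw [← e_nat_mul, e]
      push_cast
      rw [mul_div_assoc]
      congr 3
      ring
    · have hlt : ‖e x * (Real.exp (-t) : ℝ)‖ < 1 := by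
        rw [norm_mul, hz, one_mul, Complex.norm_real, Real.norm_eq_abs, Real.abs_exp]
        exact Real.exp_lt_one_iff.2 (neg_lt_zero.2 ht)
      refine ((hasSum_geometric_of_norm_lt_one hlt).mul_left
        (e x * (Real.exp (-t) : ℝ))).congr_fun fun n => ?_
      have : Real.exp (-(n + 1 : ℝ) * t) = Real.exp (-t) ^ (n + 1) := by
        rw [← Real.exp_nat_mul]; push_cast; ring_nf
      rw [this]
      push_cast
      ring
    · simp only [norm_pow, hz, one_pow]
      have := (Real.summable_one_div_nat_rpow (p := s.re)).2 hs
      exact_mod_cast (summable_nat_add_iff 1).2 this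
  have hU : IsOpen {s : ℂ | 0 < s.re} := isOpen_lt continuous_const Complex.continuous_re
  have hconn : IsPreconnected {s : ℂ | 0 < s.re} := (convex_halfSpace_re_gt 0).isPreconnected
  have h1 : DifferentiableOn ℂ (mellin g) {s : ℂ | 0 < s.re} := fun s hs =>
    (hdiff s hs).differentiableWithinAt
  have h2 : DifferentiableOn ℂ (fun s => Complex.Gamma s * HurwitzZeta.expZeta x s)
      {s : ℂ | 0 < s.re} := fun s hs => by
    refine DifferentiableAt.differentiableWithinAt (DifferentiableAt.mul ?_
      (HurwitzZeta.differentiableAt_expZeta _ _ (Or.inr hx)))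
    refine Complex.differentiableAt_Gamma _ fun m h => ?_
    have : (0 : ℝ) < s.re := hs
    rw [h] at this
    simp at this
    linarith [(Nat.cast_nonneg m : (0 : ℝ) ≤ m)]
  have key := (h1.analyticOnNhd hU).eqOn_of_preconnected_of_eventuallyEq (h2.analyticOnNhd hU) hconn
    (show (2 : ℂ) ∈ {s : ℂ | 0 < s.re} by simp) ?_ (show (1 : ℂ) ∈ {s : ℂ | 0 < s.re} by simp)
  · rw [key]; simp
  · have hV : IsOpen {s : ℂ | 1 < s.re} := isOpen_lt continuous_const Complex.continuous_re
    filter_upwards [hV.mem_nhds (show (2 : ℂ) ∈ {s : ℂ | 1 < s.re} by simp)] with s hs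
    exact hseries s hs

/-- Polar form: for `0 < x < 1` the factor `2 sin(πx)` is positive, so the argument can be read off.
-/
theorem one_sub_e_eq (x : ℝ) :
    1 - e x = (2 * Real.sin (Real.pi * x) : ℝ) *
      (Real.cos (Real.pi * x - Real.pi / 2) + Real.sin (Real.pi * x - Real.pi / 2) * Complex.I) := by
  have h : e x = Real.cos (2 * (Real.pi * x)) + Real.sin (2 * (Real.pi * x)) * Complex.I := by
    rw [e, Complex.ofReal_cos, Complex.ofReal_sin, ← Complex.exp_mul_I]
    push_cast
    ring_nf
  rw [h, Real.cos_two_mul', Real.sin_two_mul, Real.cos_sub_pi_div_two, Real.sin_sub_pi_div_two]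
  have h2 : ((Real.sin (Real.pi * x)) ^ 2 + (Real.cos (Real.pi * x)) ^ 2 : ℂ) = 1 := by
    exact_mod_cast Real.sin_sq_add_cos_sq (Real.pi * x)
  push_cast at h2 ⊢
  linear_combination -h2

theorem arg_one_sub_e {x : ℝ} (h0 : 0 < x) (h1 : x < 1) :
    Complex.arg (1 - e x) = Real.pi * x - Real.pi / 2 := by
  have hpi := Real.pi_pos
  rw [one_sub_e_eq]
  push_cast
  have hs : 0 < 2 * Real.sin (Real.pi * x) :=
    mul_pos two_pos (Real.sin_pos_of_pos_of_lt_pi (by positivity) (by nlinarith))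
  have := Complex.arg_mul_cos_add_sin_mul_I hs (θ := Real.pi * x - Real.pi / 2)
    ⟨by nlinarith, by nlinarith⟩
  push_cast at this
  exact this

theorem expZeta_neg_one {x : ℝ} (hx : (x : UnitAddCircle) ≠ 0) :
    HurwitzZeta.expZeta (-x) 1 = (starRingEnd ℂ) (HurwitzZeta.expZeta x 1) := by
  have hx' : ((-x : ℝ) : UnitAddCircle) ≠ 0 := by
    rw [AddCircle.coe_neg]; exact neg_ne_zero.2 hx
  have hz : ‖e x‖ = 1 := norm_e_ofReal x
  have hz1 : e x ≠ 1 := fun h => hx ((e_ofReal_eq_one_iff x).1 h)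
  have hslit : 1 - e x ∈ Complex.slitPlane := by
    simpa using one_sub_mul_mem_slitPlane hz hz1 zero_le_one le_rfl
  have hconj : 1 - e ((-x : ℝ) : ℂ) = (starRingEnd ℂ) (1 - e x) := by
    rw [map_sub, map_one, ← Complex.inv_eq_conj hz, ← e_neg, Complex.ofReal_neg]
  rw [← AddCircle.coe_neg, expZeta_one hx', expZeta_one hx, hconj,
    Complex.log_conj _ (Complex.slitPlane_arg_ne_pi hslit), map_neg]

theorem sinZeta_one {x : ℝ} (h0 : 0 < x) (h1 : x < 1) :
    HurwitzZeta.sinZeta x 1 = -(Real.pi * (x - 1 / 2) : ℝ) := by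
  have hx : (x : UnitAddCircle) ≠ 0 := fun h => by
    obtain ⟨n, hn⟩ := (AddCircle.coe_eq_zero_iff 1).1 h
    simp only [zsmul_eq_mul, mul_one] at hn
    rw [← hn] at h0 h1
    have a1 : (0 : ℤ) < n := by exact_mod_cast h0
    have a2 : n < (1 : ℤ) := by exact_mod_cast h1
    omega
  rw [HurwitzZeta.sinZeta_eq, expZeta_neg_one hx, Complex.sub_conj, expZeta_one hx, Complex.neg_im,
    Complex.log_im, arg_one_sub_e h0 h1]
  push_cast
  field_simp

theorem cosZeta_one {x : ℝ} (hx : (x : UnitAddCircle) ≠ 0) :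
    HurwitzZeta.cosZeta x 1 = -(Real.log ‖1 - e x‖ : ℝ) := by
  rw [HurwitzZeta.cosZeta_eq, expZeta_neg_one hx, Complex.add_conj, expZeta_one hx, Complex.neg_re,
    Complex.log_re]
  push_cast
  ring

theorem completedCosZeta_one {x : ℝ} (hx : (x : UnitAddCircle) ≠ 0) :
    HurwitzZeta.completedCosZeta x 1 = -(Real.log ‖1 - e x‖ : ℝ) := by
  have h := cosZeta_one hx
  rwa [HurwitzZeta.cosZeta, Function.update_of_ne one_ne_zero, Complex.Gammaℝ_one, div_one] at h

theorem isInt_iff_coe_eq_zero (x : ℚ) :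
    (∃ k : ℤ, x = k) ↔ (((x : ℚ) : ℝ) : UnitAddCircle) = 0 := by
  rw [AddCircle.coe_eq_zero_iff]
  refine exists_congr fun n => ?_
  simp only [zsmul_eq_mul, mul_one]
  exact ⟨fun h => by rw [h]; simp, fun h => by exact_mod_cast h.symm⟩

theorem coe_fract_rat (x : ℚ) :
    (((Int.fract x : ℚ) : ℝ) : UnitAddCircle) = ((x : ℝ) : UnitAddCircle) := by
  rw [← sub_eq_zero, ← AddCircle.coe_sub, AddCircle.coe_eq_zero_iff]
  exact ⟨-⌊x⌋, by rw [Int.fract]; push_cast; simp⟩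

/-- At integers oddness forces the value `0`, matching the convention for `𝔹₁`. Elsewhere `Γ_ℝ(2) =
1/π` removes the `π` in `sinZeta_one`. -/
theorem completedSinZeta_one (x : ℚ) :
    HurwitzZeta.completedSinZeta ((x : ℝ) : UnitAddCircle) 1 = -(perBernoulli 1 x : ℂ) := by
  by_cases hx : ∃ k : ℤ, x = k
  · rw [(isInt_iff_coe_eq_zero x).1 hx, perBernoulli, if_pos ⟨rfl, hx⟩]
    have := HurwitzZeta.completedSinZeta_neg 0 1
    rw [neg_zero, eq_neg_iff_add_eq_zero, ← two_mul] at this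
    simpa using this
  · rw [perBernoulli, if_neg fun h => hx h.2, ← coe_fract_rat]
    have h0 : 0 < Int.fract x := Int.fract_pos.2 fun h => hx ⟨_, h⟩
    have h1 := Int.fract_lt_one x
    have h2 := sinZeta_one (x := ((Int.fract x : ℚ) : ℝ)) (by exact_mod_cast h0)
      (by exact_mod_cast h1)
    have h3 : Complex.Gammaℝ (1 + 1) = 1 / Real.pi := by
      rw [Complex.Gammaℝ_def]
      norm_num
      rw [Complex.cpow_neg_one]
    have hpi : (Real.pi : ℂ) ≠ 0 := by exact_mod_cast Real.pi_ne_zero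
    rw [HurwitzZeta.sinZeta, h3] at h2
    field_simp at h2
    have h4 : (Polynomial.bernoulli 1).eval (Int.fract x) = Int.fract x - 1 / 2 := by
      simp [Polynomial.bernoulli_one]
    rw [h4]
    generalize Int.fract x = y at *
    push_cast at h2 ⊢
    refine mul_right_cancel₀ hpi ?_
    linear_combination h2

/-! ### Infinite products `∏ (1 - c_i q^{d_i})` -/

theorem norm_e (z : ℂ) : ‖e z‖ = Real.exp (-(2 * Real.pi * z.im)) := by
  rw [e, Complex.norm_exp]
  congr 1
  simp

/-- The cube leaves enough decay for the double series: after multiplication by `d` there remain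
`d^{-2}` and `n^{-3}`, both summable. -/
theorem exp_neg_le_div_cube {x : ℝ} (hx : 0 < x) : Real.exp (-x) ≤ 6 / x ^ 3 := by
  have h := Real.pow_div_factorial_le_exp x hx.le 3
  rw [Real.exp_neg, inv_le_comm₀ (Real.exp_pos x) (by positivity), inv_div]
  simpa [Nat.factorial] using h

theorem norm_e_ofReal_mul (d : ℝ) (τ : ℂ) :
    ‖e (d * τ)‖ = Real.exp (-(2 * Real.pi * d * τ.im)) := by
  rw [norm_e]; simp [mul_assoc]

/-- The exponents and coefficients of a product `∏ (1 - c_i q^{d_i})` that converges in the upper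
half plane, with exponents growing at least linearly. -/
structure IsQProduct {ι : Type*} (c : ι → ℂ) (d : ι → ℝ) : Prop where
  norm_le : ∀ i, ‖c i‖ ≤ 1
  nonneg : ∀ i, 0 ≤ d i
  eq_zero : ∀ i, d i = 0 → c i = 0
  summable : ∀ σ : ℝ, 1 < σ → Summable fun i => 1 / d i ^ σ

namespace IsQProduct

variable {ι : Type*} {c : ι → ℂ} {d : ι → ℝ}

theorem of_norm_le (h : IsQProduct c d) {c' : ι → ℂ} (hc : ∀ i, ‖c' i‖ ≤ ‖c i‖) :
    IsQProduct c' d where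
  norm_le i := (hc i).trans (h.norm_le i)
  nonneg := h.nonneg
  eq_zero i hi := norm_le_zero_iff.1 ((hc i).trans (by rw [h.eq_zero i hi, norm_zero]))
  summable := h.summable

theorem summable_pow (h : IsQProduct c d) {n : ℕ} (hn : 1 < n) :
    Summable fun i => 1 / d i ^ n := by
  simpa using h.summable n (by exact_mod_cast hn)

theorem norm_term_le (h : IsQProduct c d) {δ : ℝ} (hδ : 0 < δ) {τ : ℂ} (hτ : δ ≤ τ.im) (i : ι) :
    ‖-(c i * e (d i * τ))‖ ≤ 6 / (2 * Real.pi * δ) ^ 3 * (1 / d i ^ 3) := by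
  have hpi := Real.pi_pos
  rw [norm_neg, norm_mul, norm_e_ofReal_mul]
  rcases (h.nonneg i).eq_or_lt with h0 | h0
  · simp [h.eq_zero i h0.symm, ← h0]
  · calc ‖c i‖ * Real.exp (-(2 * Real.pi * d i * τ.im))
        ≤ 1 * Real.exp (-(2 * Real.pi * d i * δ)) := by
          gcongr
          exact h.norm_le i
      _ ≤ 6 / (2 * Real.pi * d i * δ) ^ 3 := by
          rw [one_mul]; exact exp_neg_le_div_cube (by positivity)
      _ = _ := by field_simp

theorem summable_norm_term (h : IsQProduct c d) {τ : ℂ} (hτ : 0 < τ.im) :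
    Summable fun i => ‖-(c i * e (d i * τ))‖ :=
  ((h.summable_pow (n := 3) (by norm_num)).mul_left _).of_nonneg_of_le (fun _ => norm_nonneg _)
    (h.norm_term_le hτ le_rfl)

theorem norm_term_lt_one (h : IsQProduct c d) {τ : ℂ} (hτ : 0 < τ.im) (i : ι) :
    ‖c i * e (d i * τ)‖ < 1 := by
  have hpi := Real.pi_pos
  rcases (h.nonneg i).eq_or_lt with h0 | h0
  · simp [h.eq_zero i h0.symm]
  · rw [norm_mul, norm_e_ofReal_mul]
    have : Real.exp (-(2 * Real.pi * d i * τ.im)) < 1 :=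
      Real.exp_lt_one_iff.2 (by rw [neg_lt_zero]; positivity)
    exact (mul_le_of_le_one_left (Real.exp_pos _).le (h.norm_le i)).trans_lt this

theorem factor_ne_zero (h : IsQProduct c d) {τ : ℂ} (hτ : 0 < τ.im) (i : ι) :
    1 + -(c i * e (d i * τ)) ≠ 0 := fun h0 => by
  have h1 := h.norm_term_lt_one hτ i
  have h2 : c i * e (d i * τ) = 1 := by linear_combination -h0
  rw [h2, norm_one] at h1
  exact lt_irrefl _ h1

theorem summable_double (h : IsQProduct c d) {τ : ℂ} (hτ : 0 < τ.im) :
    Summable fun p : ι × ℕ => (d p.1 : ℂ) * (c p.1 * e (d p.1 * τ)) ^ (p.2 + 1) := by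
  have hpi := Real.pi_pos
  have h1 : Summable fun n : ℕ => 1 / ((n : ℝ) + 1) ^ 3 := by
    have := (summable_nat_add_iff 1).2 (Real.summable_one_div_nat_pow.2 (by norm_num : 1 < 3))
    exact_mod_cast this
  have h2 := ((h.summable_pow (n := 2) (by norm_num)).mul_of_nonneg h1
    (fun i => by have := h.nonneg i; positivity) (fun n => by positivity)).mul_left
    (6 / (2 * Real.pi * τ.im) ^ 3)
  refine h2.of_norm_bounded fun p => ?_
  rcases (h.nonneg p.1).eq_or_lt with h0 | h0
  · simp [← h0]
  · rw [norm_mul, norm_pow, Complex.norm_real, Real.norm_of_nonneg h0.le, norm_mul,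
      norm_e_ofReal_mul]
    calc d p.1 * (‖c p.1‖ * Real.exp (-(2 * Real.pi * d p.1 * τ.im))) ^ (p.2 + 1)
        ≤ d p.1 * (1 * Real.exp (-(2 * Real.pi * d p.1 * τ.im))) ^ (p.2 + 1) := by
          gcongr
          exact h.norm_le p.1
      _ = d p.1 * Real.exp (-(2 * Real.pi * d p.1 * τ.im * (p.2 + 1))) := by
          rw [one_mul, ← Real.exp_nat_mul]; push_cast; ring_nf
      _ ≤ d p.1 * (6 / (2 * Real.pi * d p.1 * τ.im * (p.2 + 1)) ^ 3) := by
          gcongr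
          exact exp_neg_le_div_cube (by positivity)
      _ = _ := by field_simp

theorem hasDerivAt_factor (i : ι) (τ : ℂ) :
    HasDerivAt (fun z => 1 + -(c i * e (d i * z)))
      (-(2 * Real.pi * Complex.I * d i * (c i * e (d i * τ)))) τ := by
  have h1 : HasDerivAt (fun z : ℂ => 2 * Real.pi * Complex.I * (d i * z))
      (2 * Real.pi * Complex.I * (d i * 1)) τ := ((hasDerivAt_id τ).const_mul _).const_mul _
  have h2 := ((h1.cexp.const_mul (c i)).neg).const_add (1 : ℂ)
  refine h2.congr_deriv ?_
  rw [e]; ring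

/-- Logarithmic differentiation is termwise on a locally uniformly convergent product, and each
factor contributes a geometric series. -/
theorem hasSum_logDeriv (h : IsQProduct c d) {τ : ℂ} (hτ : 0 < τ.im) :
    HasSum (fun p : ι × ℕ => (d p.1 : ℂ) * (c p.1 * e (d p.1 * τ)) ^ (p.2 + 1))
      (-(1 / (2 * Real.pi * Complex.I) *
        logDeriv (fun z => ∏' i, (1 + -(c i * e (d i * z)))) τ)) := by
  have hS := (h.summable_double hτ).hasSum
  set S := ∑' p : ι × ℕ, (d p.1 : ℂ) * (c p.1 * e (d p.1 * τ)) ^ (p.2 + 1) with hSdef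
  have hld : ∀ i, logDeriv (fun z => 1 + -(c i * e (d i * z))) τ
      = -(2 * Real.pi * Complex.I) * (d i * (c i * e (d i * τ)) * (1 - c i * e (d i * τ))⁻¹) := by
    intro i
    rw [logDeriv_apply, (hasDerivAt_factor i τ).deriv, div_eq_mul_inv]
    ring_nf
  have hfib := hS.prod_fiberwise (g := fun i => d i * (c i * e (d i * τ)) *
      (1 - c i * e (d i * τ))⁻¹) fun i => by
    refine ((hasSum_geometric_of_norm_lt_one (h.norm_term_lt_one hτ i)).mul_left
      (d i * (c i * e (d i * τ)))).congr_fun fun n => ?_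
    ring
  have hsumld : HasSum (fun i => logDeriv (fun z => 1 + -(c i * e (d i * z))) τ)
      (-(2 * Real.pi * Complex.I) * S) := by
    simp_rw [hld]
    exact hfib.mul_left _
  -- On this half-plane `Im z` is bounded below, so the factors have one summable majorant.
  have hU : IsOpen {z : ℂ | τ.im / 2 < z.im} := isOpen_lt continuous_const Complex.continuous_im
  have hτU : τ ∈ {z : ℂ | τ.im / 2 < z.im} := by show τ.im / 2 < τ.im; linarith
  have hloc : MultipliableLocallyUniformlyOn (fun i z => 1 + -(c i * e (d i * z)))
      {z : ℂ | τ.im / 2 < z.im} := by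
    refine Summable.multipliableLocallyUniformlyOn_one_add hU
      ((h.summable_pow (n := 3) (by norm_num)).mul_left (6 / (2 * Real.pi * (τ.im / 2)) ^ 3))
      (Eventually.of_forall fun i z hz => h.norm_term_le (by positivity) (le_of_lt hz) i) fun i => ?_
    unfold e
    fun_prop
  have key := logDeriv_tprod_eq_tsum hU hτU (f := fun i z => 1 + -(c i * e (d i * z)))
    (h.factor_ne_zero hτ)
    (fun i z _ => (hasDerivAt_factor i z).differentiableAt.differentiableWithinAt)
    hsumld.summable hloc
    (tprod_one_add_ne_zero_of_summable (h.factor_ne_zero hτ) (h.summable_norm_term hτ))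
  rw [key, hsumld.tsum_eq]
  have hpi : (2 * Real.pi * Complex.I : ℂ) ≠ 0 := Complex.two_pi_I_ne_zero
  convert hS using 1
  field_simp

/-- The coefficients of the Dirichlet series attached to the logarithmic derivative of the product
on the line `Re τ = r`. -/
def dirichletCoeff (c : ι → ℂ) (d : ι → ℝ) (r : ℝ) (p : ι × ℕ) : ℂ :=
  -Complex.I * (d p.1 * (c p.1 * e (d p.1 * r)) ^ (p.2 + 1))

/-- The Mellin transform of the logarithmic derivative along a vertical line is a Dirichlet
series. -/
theorem hasMellin_logDeriv [Countable ι] (h : IsQProduct c d) (r : ℝ) {s : ℂ} (hs : 2 < s.re)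
    {f : ℂ → ℂ} (hf : ∀ τ : ℂ, 0 < τ.im →
      f τ = 1 / (2 * Real.pi * Complex.I) *
        logDeriv (fun z => ∏' i, (1 + -(c i * e (d i * z)))) τ) :
    MellinConvergent (fun t : ℝ => Complex.I * f (r + Complex.I * t)) s ∧
    HasSum (fun p : ι × ℕ => Complex.Gamma s * dirichletCoeff c d r p /
        ((2 * Real.pi * d p.1 * (p.2 + 1) : ℝ) : ℂ) ^ s)
      (mellin (fun t : ℝ => Complex.I * f (r + Complex.I * t)) s) := by
  have hpi := Real.pi_pos
  have hp : ∀ p : ι × ℕ, dirichletCoeff c d r p = 0 ∨ 0 < 2 * Real.pi * d p.1 * (p.2 + 1) := by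
    intro p
    rcases (h.nonneg p.1).eq_or_lt with h0 | h0
    · left; simp [dirichletCoeff, ← h0]
    · right; positivity
  have hF : ∀ t ∈ Ioi (0 : ℝ), HasSum (fun p : ι × ℕ => dirichletCoeff c d r p *
      (Real.exp (-(2 * Real.pi * d p.1 * (p.2 + 1)) * t) : ℝ))
      (Complex.I * f (r + Complex.I * t)) := by
    intro t ht
    have hτ : 0 < (r + Complex.I * t : ℂ).im := by simpa using ht
    rw [hf _ hτ]
    have h1 := (h.hasSum_logDeriv hτ).mul_left (-Complex.I)
    rw [neg_mul_neg] at h1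
    refine h1.congr_fun fun p => ?_
    have h2 : e (d p.1 * (r + Complex.I * t)) =
        e (d p.1 * r) * (Real.exp (-(2 * Real.pi * d p.1) * t) : ℝ) := by
      rw [mul_add, e_add]
      congr 1
      rw [e]
      push_cast
      congr 1
      linear_combination (2 * Real.pi * d p.1 * t) * Complex.I_sq
    have h3 : (Real.exp (-(2 * Real.pi * d p.1 * (p.2 + 1)) * t)) =
        Real.exp (-(2 * Real.pi * d p.1) * t) ^ (p.2 + 1) := by
      rw [← Real.exp_nat_mul]; push_cast; ring_nf
    rw [h2, h3, dirichletCoeff]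
    push_cast
    ring
  -- The factor `d` from differentiation turns `d^{-s}` into `d^{1-s}`, whence the condition `Re s >
  -- 2`.
  have hsum : Summable fun p : ι × ℕ => ‖dirichletCoeff c d r p‖ /
      (2 * Real.pi * d p.1 * (p.2 + 1)) ^ s.re := by
    have h1 : Summable fun n : ℕ => 1 / ((n : ℝ) + 1) ^ s.re := by
      have := (summable_nat_add_iff 1).2
        (Real.summable_one_div_nat_rpow.2 (by linarith : 1 < s.re))
      exact_mod_cast this
    have h2 := ((h.summable (s.re - 1) (by linarith)).mul_of_nonneg h1
      (fun i => div_nonneg zero_le_one (Real.rpow_nonneg (h.nonneg i) _))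
      (fun n => by positivity)).mul_left (1 / (2 * Real.pi) ^ s.re)
    refine h2.of_nonneg_of_le (fun p => div_nonneg (norm_nonneg _) (Real.rpow_nonneg
      (by have := h.nonneg p.1; positivity) _)) fun p => ?_
    rcases (h.nonneg p.1).eq_or_lt with h0 | h0
    · simp only [dirichletCoeff, ← h0]
      simp
      positivity
    · have h3 : ‖dirichletCoeff c d r p‖ ≤ d p.1 := by
        rw [dirichletCoeff, norm_mul, norm_neg, Complex.norm_I, one_mul, norm_mul,
          Complex.norm_real, Real.norm_of_nonneg h0.le, norm_pow, norm_mul,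
          norm_e_ofReal_mul]
        simp only [Complex.ofReal_im, mul_zero, neg_zero, Real.exp_zero, mul_one]
        exact mul_le_of_le_one_right h0.le (pow_le_one₀ (norm_nonneg _) (h.norm_le _))
      calc _ ≤ d p.1 / (2 * Real.pi * d p.1 * (p.2 + 1)) ^ s.re := by gcongr
        _ = _ := by
          rw [Real.mul_rpow (by positivity) (by positivity), Real.mul_rpow (by positivity) h0.le,
            Real.rpow_sub_one h0.ne']
          field_simp
  exact ⟨mellinConvergent_of_hasSum_exp hp (by linarith) hF hsum,
    hasSum_mellin hp (by linarith) hF hsum⟩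

end IsQProduct

/-! ### The theta unit of a coset as a product over `ℤ` -/

/-- The coefficient of `q^{|a+k|}` in the factor of the theta unit belonging to `a + k`. -/
def thetaCoeff (a b : ℚ) (k : ℤ) : ℂ :=
  if 0 < a + k then e b else if a + k < 0 then e (-b) else 0

theorem norm_thetaCoeff_le (a b : ℚ) (k : ℤ) : ‖thetaCoeff a b k‖ ≤ 1 := by
  have h1 : ‖e b‖ = 1 := by exact_mod_cast norm_e_ofReal b
  have h2 : ‖e (-b)‖ = 1 := by exact_mod_cast norm_e_ofReal (-b)
  unfold thetaCoeff
  split_ifs <;> simp [h1, h2]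

theorem isQProduct_theta (a b : ℚ) :
    IsQProduct (thetaCoeff a b) (fun k : ℤ => |(k : ℝ) + a|) where
  norm_le := norm_thetaCoeff_le a b
  nonneg _ := abs_nonneg _
  eq_zero k hk := by
    have h : a + k = 0 := by
      have := abs_eq_zero.1 hk
      rw [add_comm]
      exact_mod_cast this
    simp [thetaCoeff, h]
  summable σ hσ := (Real.summable_one_div_int_add_rpow (a : ℝ) σ).2 hσ

theorem tprod_subtype_coset (a : ℚ) (S : Set ℚ) (hS : ∀ y ∈ S, ∃ k : ℤ, y = a + k) (g : ℚ → ℂ) :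
    ∏' y : S, g y = ∏' k : ℤ, S.mulIndicator g (a + k) := by
  rw [tprod_subtype S g]
  have hinj : Function.Injective fun k : ℤ => a + (k : ℚ) := fun k l h => by
    simpa using h
  refine (hinj.tprod_eq fun y hy => ?_).symm
  have hyS : y ∈ S := by
    by_contra h
    exact hy (mulIndicator_of_notMem h g)
  obtain ⟨k, rfl⟩ := hS y hyS
  exact ⟨k, rfl⟩

/-- Each half-product is extended to all of `ℤ` by factors `1`. An index with `a + k = 0` belongs to
neither half, which is why `thetaCoeff` vanishes there. -/
theorem thetaUnitCoset_eq_tprod (a b : ℚ) {τ : ℂ} (hτ : 0 < τ.im) :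
    thetaUnitCoset a b τ =
      ∏' k : ℤ, (1 + -(thetaCoeff a b k * e ((|(k : ℝ) + a| : ℝ) * τ))) := by
  have h := isQProduct_theta a b
  let cp : ℤ → ℂ := fun k => if 0 < a + k then thetaCoeff a b k else 0
  let cn : ℤ → ℂ := fun k => if a + k < 0 then thetaCoeff a b k else 0
  have hp : IsQProduct cp (fun k : ℤ => |(k : ℝ) + a|) := h.of_norm_le fun k => by
    simp only [cp]; split_ifs <;> simp
  have hn : IsQProduct cn (fun k : ℤ => |(k : ℝ) + a|) := h.of_norm_le fun k => by
    simp only [cn]; split_ifs <;> simp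
  have hP : (∏' y : {y : ℚ // 0 < y ∧ ∃ k : ℤ, y = a + k}, (1 - e ((y : ℚ) * τ) * e b)) =
      ∏' k : ℤ, (1 + -(cp k * e ((|(k : ℝ) + a| : ℝ) * τ))) := by
    refine (tprod_subtype_coset a {y : ℚ | 0 < y ∧ ∃ k : ℤ, y = a + k} (fun y hy => hy.2)
      fun y => 1 - e (y * τ) * e b).trans (tprod_congr fun k => ?_)
    by_cases hk : 0 < a + (k : ℚ)
    · rw [mulIndicator_of_mem (show a + (k : ℚ) ∈ {y : ℚ | 0 < y ∧ ∃ k : ℤ, y = a + k} from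
        ⟨hk, k, rfl⟩)]
      have hk' : 0 < (k : ℝ) + a := by rw [add_comm]; exact_mod_cast hk
      simp only [cp, thetaCoeff, if_pos hk, abs_of_pos hk']
      push_cast
      ring_nf
    · rw [mulIndicator_of_notMem fun hm => hk hm.1]
      simp [cp, hk]
  have hN : (∏' y : {y : ℚ // y < 0 ∧ ∃ k : ℤ, y = a + k}, (1 - e (-(y : ℚ) * τ) * e (-b))) =
      ∏' k : ℤ, (1 + -(cn k * e ((|(k : ℝ) + a| : ℝ) * τ))) := by
    refine (tprod_subtype_coset a {y : ℚ | y < 0 ∧ ∃ k : ℤ, y = a + k} (fun y hy => hy.2)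
      fun y => 1 - e (-y * τ) * e (-b)).trans (tprod_congr fun k => ?_)
    by_cases hk : a + (k : ℚ) < 0
    · rw [mulIndicator_of_mem (show a + (k : ℚ) ∈ {y : ℚ | y < 0 ∧ ∃ k : ℤ, y = a + k} from
        ⟨hk, k, rfl⟩)]
      have hk' : (k : ℝ) + a < 0 := by rw [add_comm]; exact_mod_cast hk
      simp only [cn, thetaCoeff, if_pos hk, if_neg hk.not_gt, abs_of_neg hk']
      push_cast
      ring_nf
    · rw [mulIndicator_of_notMem fun hm => hk hm.1]
      simp [cn, hk]
  rw [thetaUnitCoset, hP, hN, ← Multipliable.tprod_mul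
    (multipliable_one_add_of_summable (hp.summable_norm_term hτ))
    (multipliable_one_add_of_summable (hn.summable_norm_term hτ))]
  refine tprod_congr fun k => ?_
  simp only [cp, cn]
  rcases lt_trichotomy 0 (a + (k : ℚ)) with hk | hk | hk
  · simp [hk, hk.not_gt]
  · simp [← hk, thetaCoeff]
  · simp [hk, hk.not_gt]

/-! ### Analytic continuation of the Mellin transform -/

open HurwitzZeta

open Classical in
/-- The continuation of `(s-1) Λ_even(x, s-1) Λ_cos(y, s)` across `s = 1`, for `x`, `y` not both
zero. -/
def evenPart (x y : UnitAddCircle) (s : ℂ) : ℂ :=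
  (s - 1) * (completedHurwitzZetaEven₀ x (s - 1) - 1 / (1 - (s - 1))) *
      (completedCosZeta₀ y s - 1 / s)
    - (if x = 0 then 1 else 0) * (completedCosZeta₀ y s - 1 / s)
    + (if y = 0 then 1 else 0) * (completedHurwitzZetaEven₀ x (s - 1) - 1 / (1 - (s - 1)))

/-- A polar term `1/(s-1)` of one factor is absorbed by `s - 1`. If `x = y = 0`, the product of two
polar terms would leave a pole; the hypothesis excludes this. -/
theorem evenPart_eq {x y : UnitAddCircle} (h : ¬(x = 0 ∧ y = 0)) {s : ℂ} (hs : s ≠ 1) :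
    evenPart x y s = (s - 1) * completedHurwitzZetaEven x (s - 1) * completedCosZeta y s := by
  have hs1 : s - 1 ≠ 0 := sub_ne_zero.2 hs
  have hs2 : 1 - s ≠ 0 := sub_ne_zero.2 hs.symm
  rw [completedHurwitzZetaEven_eq, completedCosZeta_eq, evenPart]
  have hinv : (1 : ℂ) / (1 - s) = -(1 / (s - 1)) := by rw [← neg_sub s 1, div_neg]
  have hinv2 : (s - 1) * (1 / (s - 1)) = 1 := mul_one_div_cancel hs1
  by_cases hx : x = 0
  · have hy : y ≠ 0 := fun hy => h ⟨hx, hy⟩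
    simp only [hx, hy, if_true, if_false, zero_div, sub_zero]
    linear_combination (completedCosZeta₀ y s - 1 / s) * hinv2
  · by_cases hy : y = 0
    · simp only [hx, hy, if_true, if_false, zero_div, sub_zero, hinv]
      linear_combination (-(completedHurwitzZetaEven₀ x (s - 1) - 1 / (1 - (s - 1)))) * hinv2
    · simp [hx, hy]

theorem differentiableOn_evenPart (x y : UnitAddCircle) :
    DifferentiableOn ℂ (evenPart x y) {0, 2}ᶜ := by
  intro s hs
  have h0 : s ≠ 0 := fun h => hs (by simp [h])
  have h2 : 1 - (s - 1) ≠ 0 := fun h => hs (by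
    right; rw [mem_singleton_iff]; linear_combination -h)
  have hA : DifferentiableAt ℂ
      (fun s => completedHurwitzZetaEven₀ x (s - 1) - 1 / (1 - (s - 1))) s := by
    refine DifferentiableAt.sub ?_ ((differentiableAt_const _).div (by fun_prop) h2)
    exact (differentiable_completedHurwitzZetaEven₀ x _).comp s (by fun_prop)
  have hB : DifferentiableAt ℂ (fun s => completedCosZeta₀ y s - 1 / s) s :=
    (differentiable_completedCosZeta₀ y s).sub ((differentiableAt_const _).div (by fun_prop) h0)
  unfold evenPart
  exact (((((differentiableAt_id.sub_const 1).mul hA).mul hB).sub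
    (hB.const_mul _)).add (hA.const_mul _)).differentiableWithinAt

-- The factor `s - 1` kills the first summand, and the functional equation turns the even Hurwitz
-- value at `0` into a cosine zeta value at `1`.
open Classical in
theorem evenPart_one {x y : UnitAddCircle} (h : ¬(x = 0 ∧ y = 0)) :
    evenPart x y 1 = (if y = 0 then completedCosZeta x 1 else 0)
      - (if x = 0 then completedCosZeta y 1 else 0) := by
  have hA : x ≠ 0 → completedHurwitzZetaEven₀ x (1 - 1) - 1 / (1 - (1 - 1)) =
      completedCosZeta x 1 := fun hx => by
    rw [← completedHurwitzZetaEven_one_sub, completedHurwitzZetaEven_eq, if_neg hx]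
    simp
  have hB : y ≠ 0 → completedCosZeta₀ y 1 - 1 / 1 = completedCosZeta y 1 := fun hy => by
    rw [completedCosZeta_eq, if_neg hy]
    simp
  rw [evenPart]
  by_cases hx : x = 0
  · have hy : y ≠ 0 := fun hy => h ⟨hx, hy⟩
    rw [hB hy]
    simp [hx, hy]
  · rw [hA hx]
    by_cases hy : y = 0 <;> simp [hx, hy]

/-- The contribution of the residue class with parameters `x`, `y` to the continued Mellin
transform. -/
def mellinPart (x y : UnitAddCircle) (s : ℂ) : ℂ :=
  evenPart x y s / (2 * Real.pi) +
    Complex.I * completedHurwitzZetaOdd x (s - 1) * completedSinZeta y s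

theorem differentiableOn_mellinPart (x y : UnitAddCircle) :
    DifferentiableOn ℂ (mellinPart x y) {0, 2}ᶜ := by
  refine DifferentiableOn.add ((differentiableOn_evenPart x y).div_const _) ?_
  have h1 : Differentiable ℂ fun s => completedHurwitzZetaOdd x (s - 1) :=
    (differentiable_completedHurwitzZetaOdd x).comp (differentiable_id.sub_const 1)
  exact ((h1.const_mul Complex.I).mul (differentiable_completedSinZeta y)).differentiableOn

/-- Duplication gives `Γ_ℝ(s) Γ_ℝ(s+1) = 2 (2π)^{-s} Γ(s)`, exactly the factors completing the
odd-sine product. The even-cosine product needs `Γ_ℝ(s-1)` instead of `Γ_ℝ(s+1)`; the quotient is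
`(s-1)/(2π)`. -/
theorem mellinPart_eq {x y : UnitAddCircle} (h : ¬(x = 0 ∧ y = 0)) {s : ℂ} (hs : 2 < s.re) :
    mellinPart x y s = 2 * (2 * Real.pi : ℂ) ^ (-s) * Complex.Gamma s *
      (hurwitzZetaEven x (s - 1) * cosZeta y s +
        Complex.I * hurwitzZetaOdd x (s - 1) * sinZeta y s) := by
  have hs1 : s ≠ 1 := fun h => by norm_num [h] at hs
  have hs0 : s ≠ 0 := fun h => by norm_num [h] at hs
  have hs1' : s - 1 ≠ 0 := sub_ne_zero.2 hs1
  have hpi : (Real.pi : ℂ) ≠ 0 := by exact_mod_cast Real.pi_ne_zero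
  have g0 : Complex.Gammaℝ (s - 1) ≠ 0 := Complex.Gammaℝ_ne_zero_of_re_pos (by simp; linarith)
  have g1 : Complex.Gammaℝ s ≠ 0 := Complex.Gammaℝ_ne_zero_of_re_pos (by linarith)
  have g2 : Complex.Gammaℝ (s + 1) ≠ 0 := Complex.Gammaℝ_ne_zero_of_re_pos (by simp; linarith)
  have e1 : Complex.Gammaℝ (s + 1) = Complex.Gammaℝ (s - 1) * (s - 1) / 2 / Real.pi := by
    rw [← Complex.Gammaℝ_add_two hs1']; congr 1; ring
  rw [mellinPart, evenPart_eq h hs1, ← Complex.Gammaℂ, ← Complex.Gammaℝ_mul_Gammaℝ_add_one,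
    hurwitzZetaEven_def_of_ne_or_ne (Or.inr hs1'), cosZeta, Function.update_of_ne hs0,
    hurwitzZetaOdd, sinZeta, sub_add_cancel]
  have h1 : Complex.Gammaℝ s * Complex.Gammaℝ (s + 1) *
      (Complex.I * (completedHurwitzZetaOdd x (s - 1) / Complex.Gammaℝ s) *
        (completedSinZeta y s / Complex.Gammaℝ (s + 1))) =
      Complex.I * completedHurwitzZetaOdd x (s - 1) * completedSinZeta y s := by
    field_simp
  rw [mul_add, h1, e1]
  field_simp

/-! ### The Dirichlet series sorted by residue classes modulo `β` -/

theorem coe_add_intCast (x : ℝ) (n : ℤ) : ((x + n : ℝ) : UnitAddCircle) = x := by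
  have h : ((n : ℝ) : UnitAddCircle) = 0 := (AddCircle.coe_eq_zero_iff 1).2 ⟨n, by simp⟩
  rw [AddCircle.coe_add, h, add_zero]

/-- The arguments of the two Bernoulli functions in the Dedekind sum. -/
def dedekindFst (β : ℕ) (a : ℚ) (l : ℕ) : ℚ := (a + l) / β

def dedekindSnd (α : ℤ) (β : ℕ) (a b : ℚ) (l : ℕ) : ℚ := b + (α : ℚ) / β * (a + l)

theorem not_isInt_dedekind {a b : ℚ} (hab : ¬((∃ k : ℤ, a = k) ∧ ∃ k : ℤ, b = k)) {α : ℤ} {β : ℕ}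
    (hβ : 0 < β) (l : ℕ) :
    ¬((((dedekindFst β a l : ℚ) : ℝ) : UnitAddCircle) = 0 ∧
      (((dedekindSnd α β a b l : ℚ) : ℝ) : UnitAddCircle) = 0) := by
  rw [← isInt_iff_coe_eq_zero, ← isInt_iff_coe_eq_zero]
  rintro ⟨⟨m, hm⟩, n, hn⟩
  have hβ' : (β : ℚ) ≠ 0 := by positivity
  rw [dedekindFst, div_eq_iff hβ'] at hm
  refine hab ⟨⟨m * β - l, by push_cast; linarith⟩, n - α * m, ?_⟩
  rw [dedekindSnd, hm] at hn
  field_simp at hn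
  push_cast
  linarith

theorem e_pow_eq_cos_add_sin (y : ℝ) (n : ℕ) :
    e y ^ n = Real.cos (2 * Real.pi * y * n) + Complex.I * Real.sin (2 * Real.pi * y * n) := by
  rw [← e_nat_mul, e, Complex.ofReal_cos, Complex.ofReal_sin, mul_comm Complex.I,
    ← Complex.exp_mul_I]
  push_cast
  ring_nf

/-- Coefficient and exponential combine to `e(±(b + (k+a)r))`; the sign of `k + a` affects only the
sine. -/
theorem thetaCoeff_mul_e_pow {a b r : ℚ} {k : ℤ} (hk : (k : ℝ) + a ≠ 0) (n : ℕ) :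
    (thetaCoeff a b k * e ((|(k : ℝ) + a| : ℝ) * (r : ℝ))) ^ n =
      Real.cos (2 * Real.pi * (b + (k + a) * r) * n) +
        Complex.I * (SignType.sign ((k : ℝ) + a) *
          Real.sin (2 * Real.pi * (b + (k + a) * r) * n)) := by
  rcases lt_or_gt_of_ne hk with h | h
  · have h' : a + (k : ℚ) < 0 := by rw [add_comm]; exact_mod_cast h
    have h1 : thetaCoeff a b k * e ((|(k : ℝ) + a| : ℝ) * (r : ℝ)) =
        e ((-(b + (k + a) * r) : ℝ) : ℂ) := by
      rw [thetaCoeff, if_neg h'.not_gt, if_pos h', abs_of_neg h, ← e_add]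
      congr 1
      push_cast
      ring
    rw [h1, e_pow_eq_cos_add_sin, sign_neg h, mul_neg, neg_mul, Real.cos_neg, Real.sin_neg]
    simp
  · have h' : 0 < a + (k : ℚ) := by rw [add_comm]; exact_mod_cast h
    have h1 : thetaCoeff a b k * e ((|(k : ℝ) + a| : ℝ) * (r : ℝ)) =
        e ((b + (k + a) * r : ℝ) : ℂ) := by
      rw [thetaCoeff, if_pos h', abs_of_pos h, ← e_add]
      congr 1
      push_cast
      ring
    rw [h1, e_pow_eq_cos_add_sin, sign_pos h]
    simp

theorem hasSum_dirichletCoeff_fiber {a b r : ℚ} (k : ℤ) {s : ℂ} (hs : 1 < s.re) :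
    HasSum (fun n : ℕ => Complex.Gamma s *
        IsQProduct.dirichletCoeff (thetaCoeff a b) (fun k : ℤ => |(k : ℝ) + a|) r (k, n) /
        ((2 * Real.pi * |(k : ℝ) + a| * (n + 1) : ℝ) : ℂ) ^ s)
      (-Complex.I * Complex.Gamma s * (2 * Real.pi : ℂ) ^ (-s) *
        ((1 / ((|(k : ℝ) + a| : ℝ) : ℂ) ^ (s - 1)) *
            cosZeta ((b + (k + a) * r : ℝ) : UnitAddCircle) s +
        Complex.I * (SignType.sign ((k : ℝ) + a) / ((|(k : ℝ) + a| : ℝ) : ℂ) ^ (s - 1)) *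
          sinZeta ((b + (k + a) * r : ℝ) : UnitAddCircle) s)) := by
  have hs0 : s ≠ 0 := fun h => by norm_num [h] at hs
  have hs1 : s - 1 ≠ 0 := fun h => by
    have : s = 1 := by linear_combination h
    norm_num [this] at hs
  -- Here both sides vanish: `0 ^ (s-1) = 0`, and its inverse is `0` by convention.
  by_cases hk : (k : ℝ) + a = 0
  · simp [IsQProduct.dirichletCoeff, hk, Complex.zero_cpow hs1]
  have hd : 0 < |(k : ℝ) + a| := abs_pos.2 hk
  have hd' : ((|(k : ℝ) + a| : ℝ) : ℂ) ≠ 0 := by exact_mod_cast hd.ne'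
  have hpi := Real.pi_pos
  have hC := hasSum_nat_cosZeta (b + (k + a) * r : ℝ) hs
  have hS := hasSum_nat_sinZeta (b + (k + a) * r : ℝ) hs
  rw [← hasSum_nat_add_iff' 1] at hC hS
  simp only [Finset.range_one, Finset.sum_singleton, Nat.cast_zero, Complex.zero_cpow hs0,
      div_zero, sub_zero] at hC hS
  refine (((hC.mul_left (1 / ((|(k : ℝ) + a| : ℝ) : ℂ) ^ (s - 1))).add
    (hS.mul_left (Complex.I * (SignType.sign ((k : ℝ) + a) /
      ((|(k : ℝ) + a| : ℝ) : ℂ) ^ (s - 1))))).mul_left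
      (-Complex.I * Complex.Gamma s * (2 * Real.pi : ℂ) ^ (-s))).congr_fun fun n => ?_
  have h1 : ((2 * Real.pi * |(k : ℝ) + a| * (n + 1) : ℝ) : ℂ) ^ s =
      (2 * Real.pi : ℂ) ^ s * ((|(k : ℝ) + a| : ℝ) : ℂ) ^ s * ((n + 1 : ℕ) : ℂ) ^ s := by
    rw [Complex.ofReal_mul, Complex.mul_cpow_ofReal_nonneg (by positivity) (by positivity),
      Complex.ofReal_mul, Complex.mul_cpow_ofReal_nonneg (by positivity) hd.le]
    push_cast
    rfl
  have h2 : (2 * Real.pi : ℂ) ^ s ≠ 0 := by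
    rw [Ne, Complex.cpow_eq_zero_iff, not_and_or]
    left
    exact_mod_cast (by positivity : 2 * Real.pi ≠ 0)
  have h3 : ((|(k : ℝ) + a| : ℝ) : ℂ) ^ s ≠ 0 := by
    rw [Ne, Complex.cpow_eq_zero_iff, not_and_or]
    exact Or.inl hd'
  have h4 : ((n + 1 : ℕ) : ℂ) ^ s ≠ 0 := by
    rw [Ne, Complex.cpow_eq_zero_iff, not_and_or]
    exact Or.inl (Nat.cast_ne_zero.2 n.succ_ne_zero)
  rw [IsQProduct.dirichletCoeff, h1, thetaCoeff_mul_e_pow hk, Complex.cpow_neg,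
    Complex.cpow_sub _ _ hd', Complex.cpow_one]
  generalize ((|(k : ℝ) + a| : ℝ) : ℂ) ^ s = A at *
  generalize (2 * Real.pi : ℂ) ^ s = B at *
  generalize ((n + 1 : ℕ) : ℂ) ^ s = C at *
  field_simp

/-- With `k = mβ + l` one has `|k+a| = β|m+x|`, while the phase is `y + mα`, equal to `y` mod `1`.
The two-sided sum over `m` is a Hurwitz zeta function, doubled because its series carries a factor
`1/2`. -/
theorem hasSum_residueClass {a b : ℚ} (α : ℤ) {β : ℕ} (hβ : 0 < β)
    (hab : ¬((∃ k : ℤ, a = k) ∧ ∃ k : ℤ, b = k)) (l : ℕ) {s : ℂ} (hs : 2 < s.re) (g : ℤ → ℂ)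
    (hg : ∀ k, g k = -Complex.I * Complex.Gamma s * (2 * Real.pi : ℂ) ^ (-s) *
        ((1 / ((|(k : ℝ) + a| : ℝ) : ℂ) ^ (s - 1)) *
            cosZeta ((b + (k + a) * ((α / β : ℚ) : ℝ) : ℝ) : UnitAddCircle) s +
        Complex.I * (SignType.sign ((k : ℝ) + a) / ((|(k : ℝ) + a| : ℝ) : ℂ) ^ (s - 1)) *
          sinZeta ((b + (k + a) * ((α / β : ℚ) : ℝ) : ℝ) : UnitAddCircle) s)) :
    HasSum (fun m : ℤ => g (m * β + l))
      (-Complex.I * (β : ℂ) ^ (1 - s) *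
        mellinPart ((dedekindFst β a l : ℝ) : UnitAddCircle)
          ((dedekindSnd α β a b l : ℝ) : UnitAddCircle) s) := by
  have hβ' : (0 : ℝ) < β := by exact_mod_cast hβ
  have hs1 : 1 < (s - 1).re := by simp; linarith
  rw [mellinPart_eq (not_isInt_dedekind hab hβ l) hs]
  have hE := (hasSum_int_hurwitzZetaEven (dedekindFst β a l : ℝ) hs1).mul_right
    (cosZeta ((dedekindSnd α β a b l : ℝ) : UnitAddCircle) s)
  have hO := ((hasSum_int_hurwitzZetaOdd (dedekindFst β a l : ℝ) hs1).mul_left Complex.I).mul_right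
    (sinZeta ((dedekindSnd α β a b l : ℝ) : UnitAddCircle) s)
  have h := (hE.add hO).mul_left (-Complex.I * (β : ℂ) ^ (1 - s) *
    (2 * (2 * Real.pi : ℂ) ^ (-s) * Complex.Gamma s))
  rw [← mul_assoc]
  refine h.congr_fun fun m => ?_
  have h1 : (((m * β + l : ℤ) : ℝ) + a) = β * (m + dedekindFst β a l) := by
    rw [dedekindFst]
    push_cast
    field_simp
    ring
  have h2 : ((b + (((m * β + l : ℤ) : ℝ) + a) * ((α / β : ℚ) : ℝ) : ℝ) : UnitAddCircle) =
      ((dedekindSnd α β a b l : ℝ) : UnitAddCircle) := by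
    rw [← coe_add_intCast (dedekindSnd α β a b l) (m * α)]
    congr 1
    rw [dedekindSnd]
    push_cast
    field_simp
    ring
  have h3 : SignType.sign ((β : ℝ) * (m + dedekindFst β a l)) =
      SignType.sign ((m : ℝ) + dedekindFst β a l) := by
    rw [sign_mul, sign_pos hβ', one_mul]
  have h4 : (((|(β : ℝ) * (m + dedekindFst β a l)| : ℝ)) : ℂ) ^ (s - 1) =
      (β : ℂ) ^ (s - 1) * ((|(m : ℝ) + dedekindFst β a l| : ℝ) : ℂ) ^ (s - 1) := by
    rw [abs_mul, abs_of_pos hβ', Complex.ofReal_mul,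
      Complex.mul_cpow_ofReal_nonneg hβ'.le (abs_nonneg _), Complex.ofReal_natCast]
  have h5 : (β : ℂ) ^ (1 - s) = ((β : ℂ) ^ (s - 1))⁻¹ := by
    rw [← Complex.cpow_neg, neg_sub]
  rw [hg, h2, h1, h3, h4, h5]
  ring

/-- The analytic continuation of the Mellin transform of `dlog` of the theta unit. -/
def mellinContinuation (α : ℤ) (β : ℕ) (a b : ℚ) (s : ℂ) : ℂ :=
  ∑ l ∈ Finset.range β, -Complex.I * (β : ℂ) ^ (1 - s) *
    mellinPart ((dedekindFst β a l : ℝ) : UnitAddCircle)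
      ((dedekindSnd α β a b l : ℝ) : UnitAddCircle) s

theorem differentiableOn_mellinContinuation (α : ℤ) {β : ℕ} (hβ : 0 < β) (a b : ℚ) :
    DifferentiableOn ℂ (mellinContinuation α β a b) {0, 2}ᶜ := by
  have hβ' : (β : ℂ) ≠ 0 := by exact_mod_cast hβ.ne'
  unfold mellinContinuation
  refine DifferentiableOn.fun_sum fun l _ => DifferentiableOn.mul ?_
    (differentiableOn_mellinPart _ _)
  refine Differentiable.differentiableOn (Differentiable.const_mul ?_ _)
  exact fun s => (DifferentiableAt.const_cpow (by fun_prop) (Or.inl hβ'))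

theorem hasSum_mellinContinuation {a b : ℚ} (α : ℤ) {β : ℕ} (hβ : 0 < β)
    (hab : ¬((∃ k : ℤ, a = k) ∧ ∃ k : ℤ, b = k)) {s P : ℂ} (hs : 2 < s.re)
    (h : HasSum (fun p : ℤ × ℕ => Complex.Gamma s *
        IsQProduct.dirichletCoeff (thetaCoeff a b) (fun k : ℤ => |(k : ℝ) + a|)
          ((α / β : ℚ) : ℝ) p /
        ((2 * Real.pi * |(p.1 : ℝ) + a| * (p.2 + 1) : ℝ) : ℂ) ^ s) P) :
    mellinContinuation α β a b s = P := by
  obtain ⟨g, hg⟩ : ∃ g : ℤ → ℂ, ∀ k, g k = -Complex.I * Complex.Gamma s *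
        (2 * Real.pi : ℂ) ^ (-s) *
        ((1 / ((|(k : ℝ) + a| : ℝ) : ℂ) ^ (s - 1)) *
            cosZeta ((b + (k + a) * ((α / β : ℚ) : ℝ) : ℝ) : UnitAddCircle) s +
        Complex.I * (SignType.sign ((k : ℝ) + a) / ((|(k : ℝ) + a| : ℝ) : ℂ) ^ (s - 1)) *
          sinZeta ((b + (k + a) * ((α / β : ℚ) : ℝ) : ℝ) : UnitAddCircle) s) := ⟨_, fun _ => rfl⟩
  have h1 : HasSum g P := h.prod_fiberwise fun k => by
    rw [hg]; exact hasSum_dirichletCoeff_fiber k (by linarith)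
  have : NeZero β := ⟨hβ.ne'⟩
  have h2 := ((Equiv.prodComm _ _).trans (Int.divModEquiv β).symm).hasSum_iff.2 h1
  have h3 := h2.prod_fiberwise (g := fun l : Fin β => -Complex.I * (β : ℂ) ^ (1 - s) *
    mellinPart ((dedekindFst β a l : ℝ) : UnitAddCircle)
      ((dedekindSnd α β a b l : ℝ) : UnitAddCircle) s) fun l =>
    hasSum_residueClass α hβ hab l hs g hg
  rw [mellinContinuation, Finset.sum_range]
  exact (hasSum_fintype _).unique h3

/-! ### The value at `s = 1` -/

open Classical in
/-- The logarithmic correction terms in the value at `s = 1`. -/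
def logTerm (α : ℤ) (β : ℕ) (a b : ℚ) (l : ℕ) : ℝ :=
  (if ∃ k : ℤ, dedekindSnd α β a b l = k then rclogCoset (dedekindFst β a l) else 0)
    - (if ∃ k : ℤ, dedekindFst β a l = k then rclogCoset (dedekindSnd α β a b l) else 0)

theorem mellinContinuation_one {a b : ℚ} (α : ℤ) {β : ℕ} (hβ : 0 < β)
    (hab : ¬((∃ k : ℤ, a = k) ∧ ∃ k : ℤ, b = k)) :
    mellinContinuation α β a b 1 = (dedekindC α β a b : ℂ) -
      1 / (2 * Real.pi * Complex.I) * ((∑ l ∈ Finset.range β, logTerm α β a b l : ℝ) : ℂ) := by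
  classical
  have hpi : (Real.pi : ℂ) ≠ 0 := by exact_mod_cast Real.pi_ne_zero
  rw [mellinContinuation, dedekindC]
  push_cast
  rw [Finset.mul_sum, ← Finset.sum_sub_distrib]
  refine Finset.sum_congr rfl fun l _ => ?_
  have hxy := not_isInt_dedekind hab (α := α) hβ l
  have hev : evenPart ((dedekindFst β a l : ℝ) : UnitAddCircle)
      ((dedekindSnd α β a b l : ℝ) : UnitAddCircle) 1 = -(logTerm α β a b l : ℂ) := by
    rw [evenPart_one hxy, logTerm]
    simp only [isInt_iff_coe_eq_zero, rclogCoset]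
    by_cases hx : ((dedekindFst β a l : ℝ) : UnitAddCircle) = 0
    · have hy := fun hy => hxy ⟨hx, hy⟩
      rw [if_neg hy, if_pos hx, if_neg hy, if_pos hx, completedCosZeta_one hy]
      push_cast
      ring
    · by_cases hy : ((dedekindSnd α β a b l : ℝ) : UnitAddCircle) = 0
      · rw [if_neg hx, if_pos hy, if_neg hx, if_pos hy, completedCosZeta_one hx]
        push_cast
        ring
      · simp [hx, hy]
  have hodd : completedHurwitzZetaOdd ((dedekindFst β a l : ℝ) : UnitAddCircle) (1 - 1) =
      -(perBernoulli 1 (dedekindFst β a l) : ℂ) := by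
    rw [completedHurwitzZetaOdd_one_sub, completedSinZeta_one]
  rw [mellinPart, hev, hodd, completedSinZeta_one, sub_self, Complex.cpow_zero, dedekindFst,
    dedekindSnd]
  generalize perBernoulli 1 ((a + l) / β) = A
  generalize perBernoulli 1 (b + (α : ℚ) / β * (a + l)) = B
  field_simp
  linear_combination (logTerm α β a b l - 2 * Real.pi * A * B * Complex.I) * Complex.I_sq

theorem hasRegularizedPeriod_of_eq_logDeriv {a b : ℚ} (α : ℤ) {β : ℕ} (hβ : 0 < β)
    (hab : ¬((∃ k : ℤ, a = k) ∧ ∃ k : ℤ, b = k)) {F : ℂ → ℂ}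
    (hF : ∀ τ : ℂ, 0 < τ.im → F τ = 1 / (2 * Real.pi * Complex.I) *
      logDeriv (fun z => ∏' k : ℤ, (1 + -(thetaCoeff a b k * e ((|(k : ℝ) + a| : ℝ) * z)))) τ) :
    HasRegularizedPeriod F ((α : ℚ) / (β : ℚ)) ((dedekindC α β a b : ℂ) -
      1 / (2 * Real.pi * Complex.I) * ((∑ l ∈ Finset.range β, logTerm α β a b l : ℝ) : ℂ)) := by
  refine ⟨mellinContinuation α β a b, differentiableOn_mellinContinuation α hβ a b, fun s hs => ?_,
    mellinContinuation_one α hβ hab⟩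
  obtain ⟨h1, h2⟩ := (isQProduct_theta a b).hasMellin_logDeriv (((α : ℚ) / (β : ℚ) : ℚ) : ℝ) hs hF
  rw [Complex.ofReal_ratCast] at h1 h2
  exact ⟨h1, hasSum_mellinContinuation α hβ hab hs h2⟩

/-! ### Distributions on cosets -/

theorem level_eq_one {f : V → ℤ} (hf : IsInvariant 1 f) : level f = 1 := by
  have hmem : (1 : ℕ) ∈ {n : ℕ | 0 < n ∧ IsInvariant n f} := ⟨one_pos, hf⟩
  exact le_antisymm (Nat.sInf_le hmem) (Nat.sInf_mem ⟨1, hmem⟩).1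

theorem isInvariant_coset (a b : ℚ) : IsInvariant 1 (coset a b) := by
  intro v k
  have h : ∀ (x c : ℚ) (n : ℤ), (∃ m : ℤ, x + ((1 : ℕ) : ℚ) * n = c + m) ↔ ∃ m : ℤ, x = c + m := by
    intro x c n
    constructor
    · rintro ⟨m, hm⟩
      exact ⟨m - n, by push_cast at hm ⊢; linarith⟩
    · rintro ⟨m, hm⟩
      exact ⟨m + n, by push_cast; linarith⟩
  classical exact if_congr (and_congr (h _ _ _) (h _ _ _)) rfl rfl

theorem isInvariant_sub {f g : V → ℤ} {n : ℕ} (hf : IsInvariant n f) (hg : IsInvariant n g) :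
    IsInvariant n (f - g) := fun v k => by
  simp only [Pi.sub_apply, hf v k, hg v k]

/-- The representative of `(a, b)` in the unit square. -/
def unitRep (a b : ℚ) : V := ![Int.fract a, Int.fract b]

theorem unitRep_mem (a b : ℚ) : unitRep a b ∈ unitSquare := by
  intro i
  fin_cases i
  · exact ⟨Int.fract_nonneg _, Int.fract_lt_one _⟩
  · exact ⟨Int.fract_nonneg _, Int.fract_lt_one _⟩

theorem eq_fract_iff {x a : ℚ} (hx : 0 ≤ x ∧ x < 1) : (∃ k : ℤ, x = a + k) ↔ x = Int.fract a := by
  rw [eq_comm (a := x), Int.fract_eq_iff]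
  constructor
  · rintro ⟨k, hk⟩
    exact ⟨hx.1, hx.2, -k, by push_cast; linarith⟩
  · rintro ⟨-, -, k, hk⟩
    exact ⟨-k, by push_cast; linarith⟩

open Classical in
theorem coset_of_mem_unitSquare (a b : ℚ) {v : V} (hv : v ∈ unitSquare) :
    coset a b v = if v = unitRep a b then 1 else 0 := by
  have h : v = unitRep a b ↔ (v 0 = Int.fract a ∧ v 1 = Int.fract b) := by
    constructor
    · rintro rfl
      exact ⟨rfl, rfl⟩
    · rintro ⟨h0, h1⟩
      ext i
      fin_cases i
      · exact h0
      · exact h1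
  rw [coset]
  simp only [eq_fract_iff (hv 0), eq_fract_iff (hv 1), h]

theorem prodDist_coset (σ : V → ℂ) (a b : ℚ) : prodDist σ (coset a b) = σ (unitRep a b) := by
  classical
  rw [prodDist, level_eq_one (isInvariant_coset a b), finprod_eq_single _ (unitRep a b)]
  · simp [unitRep_mem, coset_of_mem_unitSquare]
  · intro v hv
    by_cases hm : v ∈ unitSquare
    · simp [hm, coset_of_mem_unitSquare, hv]
    · simp [hm]

/-- Treated as one function because `sumDist` rescales by the level of its argument, so additivity
is not immediate; here the difference still has level `1`. -/
theorem sumDist_coset_sub (σ : V → ℝ) (a b a' b' : ℚ) :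
    sumDist σ (coset a' b' - coset a b) = σ (unitRep a' b') - σ (unitRep a b) := by
  classical
  rw [sumDist, level_eq_one (isInvariant_sub (isInvariant_coset a' b') (isInvariant_coset a b))]
  have h : ∀ v : V, (∑ᶠ _ : v ∈ unitSquare,
      (((coset a' b' - coset a b) fun i => ((1 : ℕ) : ℚ) * v i : ℤ) : ℝ) * σ v) =
      (if v = unitRep a' b' then σ v else 0) - (if v = unitRep a b then σ v else 0) := by
    intro v
    by_cases hm : v ∈ unitSquare
    · simp only [hm, Nat.cast_one, one_mul, Pi.sub_apply, coset_of_mem_unitSquare]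
      rw [finsum_true]
      push_cast
      split_ifs <;> simp
    · have h1 : v ≠ unitRep a' b' := fun h => hm (h ▸ unitRep_mem _ _)
      have h2 : v ≠ unitRep a b := fun h => hm (h ▸ unitRep_mem _ _)
      simp [hm, h1, h2]
  have hs : ∀ w : V, (Function.support fun v => if v = w then σ v else 0).Finite := fun w =>
    (finite_singleton w).subset fun v hv => by
      by_contra hne
      exact hv (if_neg hne)
  have hf : ∀ w : V, ∑ᶠ v, (if v = w then σ v else 0) = σ w := fun w => by
    rw [finsum_eq_single _ w fun v hv => if_neg hv, if_pos rfl]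
  rw [finsum_congr h, finsum_sub_distrib (hs _) (hs _), hf, hf]

theorem thetaUnitCoset_fract (a b : ℚ) (τ : ℂ) :
    thetaUnitCoset (Int.fract a) (Int.fract b) τ = thetaUnitCoset a b τ := by
  have h : ∀ y : ℚ, (∃ k : ℤ, y = Int.fract a + k) ↔ ∃ k : ℤ, y = a + k := fun y => by
    constructor
    · rintro ⟨k, rfl⟩
      exact ⟨k - ⌊a⌋, by rw [Int.fract]; push_cast; ring⟩
    · rintro ⟨k, rfl⟩
      exact ⟨k + ⌊a⌋, by rw [Int.fract]; push_cast; ring⟩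
  have hb : e ((Int.fract b : ℚ) : ℂ) = e b := by
    have h1 : ((Int.fract b : ℚ) : ℂ) = b + ((-⌊b⌋ : ℤ) : ℂ) := by
      rw [Int.fract]; push_cast; ring
    rw [h1, e_add, e_int, mul_one]
  unfold thetaUnitCoset
  rw [e_neg ((Int.fract b : ℚ) : ℂ), e_neg (b : ℂ), hb]
  congr 1
  · exact (Equiv.subtypeEquivRight fun y => and_congr_right' (h y)).tprod_eq
      fun y : {y : ℚ // 0 < y ∧ ∃ k : ℤ, y = a + k} => 1 - e ((y : ℚ) * τ) * e b
  · exact (Equiv.subtypeEquivRight fun y => and_congr_right' (h y)).tprod_eq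
      fun y : {y : ℚ // y < 0 ∧ ∃ k : ℤ, y = a + k} => 1 - e (-(y : ℚ) * τ) * (e b)⁻¹

theorem thetaUnit_coset (a b : ℚ) (τ : ℂ) : thetaUnit (coset a b) τ = thetaUnitCoset a b τ := by
  rw [thetaUnit, prodDist_coset]
  exact thetaUnitCoset_fract a b τ

theorem rclogCoset_add_int (x : ℚ) (k : ℤ) : rclogCoset (x + k) = rclogCoset x := by
  rw [rclogCoset, rclogCoset]
  push_cast
  rw [e_add, e_int, mul_one]

/-- Since `1 - e(-x) = -e(x)⁻¹ (1 - e(x))`, the moduli agree. This absorbs the sign ambiguity in the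
first column of `γ`. -/
theorem rclogCoset_neg (x : ℚ) : rclogCoset (-x) = rclogCoset x := by
  have h1 : ‖e (x : ℂ)‖ = 1 := by exact_mod_cast norm_e_ofReal x
  have h2 : e (x : ℂ) ≠ 0 := Complex.exp_ne_zero _
  rw [rclogCoset, rclogCoset]
  push_cast
  have h3 : 1 - e (-(x : ℂ)) = -(e (x : ℂ))⁻¹ * (1 - e x) := by
    rw [e_neg]; field_simp; ring
  rw [h3, norm_mul, norm_neg, norm_inv, h1, inv_one, one_mul]

theorem diracTensorRClog_coset_sub (a b a' b' : ℚ) :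
    diracTensorRClog (coset a' b' - coset a b) =
      diracCoset a' * rclogCoset b' - diracCoset a * rclogCoset b := by
  have hd : ∀ x : ℚ, diracCoset (Int.fract x) = diracCoset x := fun x => by
    have : (∃ k : ℤ, Int.fract x = k) ↔ ∃ k : ℤ, x = k := by
      rw [isInt_iff_coe_eq_zero, isInt_iff_coe_eq_zero, coe_fract_rat]
    classical exact if_congr this rfl rfl
  have hr : ∀ x : ℚ, rclogCoset (Int.fract x) = rclogCoset x := fun x => by
    have : Int.fract x = x + ((-⌊x⌋ : ℤ) : ℚ) := by rw [Int.fract]; push_cast; ring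
    rw [this, rclogCoset_add_int]
  rw [diracTensorRClog, sumDist_coset_sub]
  simp [unitRep, hd, hr]

/-- Right multiplication by `γ` preserves `ℤ²`, so it carries the coset of `(a,b)` to that of
`(a,b)γ`. -/
theorem slash_coset (a b : ℚ) (γ : SL(2, ℤ)) :
    slash (coset a b) (toRat γ) =
      coset (γ 0 0 * a + γ 1 0 * b) (γ 0 1 * a + γ 1 1 * b) := by
  have hdet : (γ 0 0 : ℚ) * γ 1 1 - γ 0 1 * γ 1 0 = 1 := by
    have := γ.det_coe
    rw [Matrix.det_fin_two] at this
    exact_mod_cast this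
  have hinv : (toRat γ)⁻¹ = !![(γ 1 1 : ℚ), -γ 0 1; -γ 1 0, γ 0 0] := by
    refine Matrix.inv_eq_right_inv ?_
    ext i j
    fin_cases i <;> fin_cases j <;>
      simp [toRat, Matrix.mul_apply, Fin.sum_univ_two] <;> linarith
  ext v
  have h0 : Matrix.vecMul v (toRat γ)⁻¹ 0 = v 0 * γ 1 1 - v 1 * γ 1 0 := by
    rw [hinv]; simp [Matrix.vecMul, dotProduct, Fin.sum_univ_two]; ring
  have h1 : Matrix.vecMul v (toRat γ)⁻¹ 1 = -v 0 * γ 0 1 + v 1 * γ 0 0 := by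
    rw [hinv]; simp [Matrix.vecMul, dotProduct, Fin.sum_univ_two]
  have hiff : ((∃ k : ℤ, v 0 * γ 1 1 - v 1 * γ 1 0 = a + k) ∧
      ∃ k : ℤ, -v 0 * γ 0 1 + v 1 * γ 0 0 = b + k) ↔
      ((∃ k : ℤ, v 0 = γ 0 0 * a + γ 1 0 * b + k) ∧
        ∃ k : ℤ, v 1 = γ 0 1 * a + γ 1 1 * b + k) := by
    constructor
    · rintro ⟨⟨k, hk⟩, l, hl⟩
      refine ⟨⟨γ 0 0 * k + γ 1 0 * l, ?_⟩, γ 0 1 * k + γ 1 1 * l, ?_⟩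
      · push_cast
        linear_combination γ 0 0 * hk + γ 1 0 * hl - v 0 * hdet
      · push_cast
        linear_combination γ 0 1 * hk + γ 1 1 * hl - v 1 * hdet
    · rintro ⟨⟨k, hk⟩, l, hl⟩
      refine ⟨⟨γ 1 1 * k - γ 1 0 * l, ?_⟩, -γ 0 1 * k + γ 0 0 * l, ?_⟩
      · push_cast
        linear_combination γ 1 1 * hk - γ 1 0 * hl + a * hdet
      · push_cast
        linear_combination -γ 0 1 * hk + γ 0 0 * hl + b * hdet
  rw [← h0, ← h1] at hiff
  classical exact if_congr hiff rfl rfl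

/-! ### The logarithmic correction terms -/

theorem exists_nat_lt_dvd {β : ℕ} (hβ : 0 < β) (n : ℤ) : ∃ l < β, ∃ j : ℤ, n = l + β * j := by
  have hβ' : (β : ℤ) ≠ 0 := by exact_mod_cast hβ.ne'
  refine ⟨(n % β).toNat, ?_, n / β, ?_⟩
  · zify
    rw [Int.toNat_of_nonneg (Int.emod_nonneg _ hβ')]
    exact Int.emod_lt_of_pos _ (by exact_mod_cast hβ)
  · rw [Int.toNat_of_nonneg (Int.emod_nonneg _ hβ')]
    exact (Int.emod_add_mul_ediv n β).symm

theorem eq_of_dvd_sub {β l m : ℕ} (hl : l < β) (hm : m < β) (h : (β : ℤ) ∣ l - m) : l = m := by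
  obtain ⟨j, hj⟩ := h
  have h1 : (l : ℤ) ≡ m [ZMOD β] := (Int.modEq_iff_dvd.2 ⟨-j, by linarith⟩)
  exact Nat.ModEq.eq_of_lt_of_lt (Int.natCast_modEq_iff.1 h1) hl hm

-- An `l` with `β ∣ a + l` exists only for integral `a`; it is then unique, and `α(a+l)/β` is an
-- integer, so the second argument is `b` mod `1`.
open Classical in
theorem sum_fst_isInt (α : ℤ) {β : ℕ} (hβ : 0 < β) (a b : ℚ) :
    ∑ l ∈ Finset.range β, (if ∃ k : ℤ, dedekindFst β a l = k then
      rclogCoset (dedekindSnd α β a b l) else 0) = diracCoset a * rclogCoset b := by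
  have hβ' : (β : ℚ) ≠ 0 := by positivity
  by_cases ha : ∃ k : ℤ, a = k
  · obtain ⟨n, rfl⟩ := ha
    obtain ⟨l₀, hl₀, j, hj⟩ := exists_nat_lt_dvd hβ (-n)
    have hj' : (n : ℚ) = -(l₀ + β * j) := by
      have : n = -(l₀ + β * j) := by linarith
      exact_mod_cast this
    have hx : dedekindFst β n l₀ = ((-j : ℤ) : ℚ) := by
      rw [dedekindFst, hj', div_eq_iff hβ']; push_cast; ring
    have hy : dedekindSnd α β n b l₀ = b + ((-(α * j) : ℤ) : ℚ) := by
      rw [dedekindSnd, hj']; push_cast; field_simp; ring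
    rw [Finset.sum_eq_single_of_mem l₀ (Finset.mem_range.2 hl₀), if_pos ⟨_, hx⟩, hy,
      rclogCoset_add_int, diracCoset, if_pos ⟨n, rfl⟩, one_mul]
    intro l hl hne
    refine if_neg ?_
    rintro ⟨k, hk⟩
    rw [dedekindFst, div_eq_iff hβ', hj'] at hk
    refine hne (eq_of_dvd_sub (Finset.mem_range.1 hl) hl₀ ⟨k + j, ?_⟩)
    have : (l : ℚ) - l₀ = β * (k + j) := by linarith
    exact_mod_cast this
  · rw [diracCoset, if_neg ha, zero_mul]
    refine Finset.sum_eq_zero fun l _ => if_neg ?_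
    rintro ⟨k, hk⟩
    rw [dedekindFst, div_eq_iff hβ'] at hk
    exact ha ⟨k * β - l, by push_cast; linarith⟩

-- Here `(cα, cβ)` and `(q, s)` are the columns of `γ`, so the right side evaluates `δ₀ ⊗ RClog` at
-- `(a,b)γ`. Integrality of `y` is a congruence for `l` modulo `β`, with a unique solution as `α` is
-- invertible modulo `β`.
open Classical in
theorem sum_snd_isInt {α : ℤ} {β : ℕ} (hβ : 0 < β) (a b : ℚ) {c q s : ℤ} (hc : c = 1 ∨ c = -1)
    (hdet : c * (α * s - q * β) = 1) :
    ∑ l ∈ Finset.range β, (if ∃ k : ℤ, dedekindSnd α β a b l = k then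
      rclogCoset (dedekindFst β a l) else 0) =
      diracCoset (c * α * a + c * β * b) * rclogCoset (q * a + s * b) := by
  have hβ' : (β : ℚ) ≠ 0 := by positivity
  have hcc : c * c = 1 := by rcases hc with rfl | rfl <;> norm_num
  have hcc' : (c : ℚ) * c = 1 := by exact_mod_cast hcc
  have hdet' : α * s - q * β = c := by
    calc α * s - q * β = c * c * (α * s - q * β) := by rw [hcc, one_mul]
      _ = c := by rw [mul_assoc, hdet, mul_one]
  have hdetq : (α : ℚ) * s - q * β = c := by exact_mod_cast hdet'
  by_cases ha : ∃ k : ℤ, (c * α * a + c * β * b : ℚ) = k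
  · obtain ⟨n, hn⟩ := ha
    have hm : (α * a + β * b : ℚ) = c * n := by
      rw [← hn]; linear_combination (-(α * a + β * b)) * hcc'
    -- Integrality of `y` means `cn + αl ≡ 0` modulo `β`; as `c ≡ αs`, this reads `l ≡ -sn`.
    obtain ⟨l₀, hl₀, j, hj⟩ := exists_nat_lt_dvd hβ (-(s * n))
    have hj' : (l₀ : ℚ) = -(s * n) - β * j := by
      have : (l₀ : ℤ) = -(s * n) - β * j := by linarith
      exact_mod_cast this
    have hy : dedekindSnd α β a b l₀ = ((-(q * n) - α * j : ℤ) : ℚ) := by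
      rw [dedekindSnd, hj']
      push_cast
      field_simp
      linear_combination hm - n * hdetq
    have hx : rclogCoset (dedekindFst β a l₀) = rclogCoset (q * a + s * b) := by
      have hx1 : (q * a + s * b : ℚ) = -(c * (dedekindFst β a l₀ + j)) := by
        rw [dedekindFst, hj']
        field_simp
        linear_combination s * hm - a * hdetq
      rcases hc with rfl | rfl
      · rw [hx1, Int.cast_one, one_mul, rclogCoset_neg, rclogCoset_add_int]
      · rw [hx1, Int.cast_neg, Int.cast_one, neg_mul, one_mul, neg_neg, rclogCoset_add_int]
    rw [Finset.sum_eq_single_of_mem l₀ (Finset.mem_range.2 hl₀), if_pos ⟨_, hy⟩, hx,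
      diracCoset, if_pos ⟨n, hn⟩, one_mul]
    intro l hl hne
    refine if_neg ?_
    rintro ⟨k, hk⟩
    have h1 : (α : ℚ) * (l - l₀) = β * (k + q * n + α * j) := by
      have h2 : dedekindSnd α β a b l - dedekindSnd α β a b l₀ = α * (l - l₀) / β := by
        rw [dedekindSnd, dedekindSnd]; field_simp; ring
      rw [hk, hy] at h2
      field_simp at h2
      push_cast at h2
      linarith
    have h2 : α * ((l : ℤ) - l₀) = β * (k + q * n + α * j) := by exact_mod_cast h1
    have hcop : IsCoprime (β : ℤ) α := ⟨-(c * q), c * s, by linear_combination hdet⟩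
    exact hne (eq_of_dvd_sub (Finset.mem_range.1 hl) hl₀ (hcop.dvd_of_dvd_mul_left ⟨_, h2⟩))
  · rw [diracCoset, if_neg ha, zero_mul]
    refine Finset.sum_eq_zero fun l _ => if_neg ?_
    rintro ⟨k, hk⟩
    rw [dedekindSnd] at hk
    field_simp at hk
    refine ha ⟨c * (β * k - α * l), ?_⟩
    push_cast
    linear_combination c * hk

theorem sum_logTerm {α : ℤ} {β : ℕ} (hβ : 0 < β) (a b : ℚ) {c : ℤ} (hc : c = 1 ∨ c = -1)
    (γ : SL(2, ℤ)) (h0 : γ 0 0 = c * α) (h1 : γ 1 0 = c * β) :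
    ∑ l ∈ Finset.range β, logTerm α β a b l =
      diracTensorRClog (slash (coset a b) (toRat γ) - coset a b) := by
  have hdet : c * (α * γ 1 1 - γ 0 1 * β) = 1 := by
    have := γ.det_coe
    rw [Matrix.det_fin_two, h0, h1] at this
    linear_combination this
  rw [slash_coset, diracTensorRClog_coset_sub, h0, h1]
  unfold logTerm
  rw [Finset.sum_sub_distrib, sum_fst_isInt α hβ a b, sum_snd_isInt hβ a b hc hdet]
  push_cast
  rfl

/-! ### The period of the theta unit -/

/-- Rescaling `t` by `D` multiplies the Mellin transform by `D^{-s}`, which at `s = 1` cancels the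
factor `D` from the chain rule. -/
theorem HasRegularizedPeriod.comp_mul_left {F : ℂ → ℂ} {r : ℚ} {P : ℂ} {D : ℕ} (hD : 0 < D)
    (h : HasRegularizedPeriod F (D * r) P) :
    HasRegularizedPeriod (fun τ => D * F (D * τ)) r P := by
  obtain ⟨M, hM, hM', rfl⟩ := h
  have hD' : (D : ℂ) ≠ 0 := by exact_mod_cast hD.ne'
  have hDr : (0 : ℝ) < D := by exact_mod_cast hD
  refine ⟨fun s => D * (D : ℂ) ^ (-s) * M s, ?_, fun s hs => ?_, ?_⟩
  · refine DifferentiableOn.mul (Differentiable.differentiableOn ?_) hM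
    exact Differentiable.const_mul
      (fun s => DifferentiableAt.const_cpow (by fun_prop) (Or.inl hD')) _
  · obtain ⟨h1, h2⟩ := hM' s hs
    have hfun : (fun t : ℝ => Complex.I * (D * F (D * (r + Complex.I * t)))) =
        fun t : ℝ => (D : ℂ) • (fun t : ℝ => Complex.I * F (((D * r : ℚ) : ℂ) + Complex.I * t))
          ((D : ℝ) * t) := by
      funext t
      have : (D * (r + Complex.I * t) : ℂ) =
          ((D * r : ℚ) : ℂ) + Complex.I * ((D * t : ℝ) : ℂ) := by
        push_cast; ring
      rw [this, smul_eq_mul]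
      ring
    rw [hfun]
    refine ⟨((MellinConvergent.comp_mul_left hDr).2 h1).const_smul _, ?_⟩
    have h3 := mellin_comp_mul_left
      (fun t : ℝ => Complex.I * F (((D * r : ℚ) : ℂ) + Complex.I * t)) s hDr
    rw [mellin_const_smul, h3, ← h2]
    simp [mul_assoc]
  · simp only
    rw [Complex.cpow_neg_one, mul_inv_cancel₀ hD', one_mul]

theorem logDeriv_comp_mul_left (f : ℂ → ℂ) (c z : ℂ) :
    logDeriv (fun z => f (c * z)) z = c * logDeriv f (c * z) := by
  rw [logDeriv_apply, logDeriv_apply, deriv_comp_mul_left, smul_eq_mul, mul_div_assoc]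

theorem logDeriv_thetaUnit_coset (a b : ℚ) {τ : ℂ} (hτ : 0 < τ.im) :
    logDeriv (thetaUnit (coset a b)) τ =
      logDeriv (fun z => ∏' k : ℤ, (1 + -(thetaCoeff a b k * e ((|(k : ℝ) + a| : ℝ) * z)))) τ := by
  have hU : IsOpen {z : ℂ | 0 < z.im} := isOpen_lt continuous_const Complex.continuous_im
  have h : thetaUnit (coset a b) =ᶠ[𝓝 τ]
      fun z => ∏' k : ℤ, (1 + -(thetaCoeff a b k * e ((|(k : ℝ) + a| : ℝ) * z))) := by
    filter_upwards [hU.mem_nhds hτ] with z hz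
    rw [thetaUnit_coset, thetaUnitCoset_eq_tprod a b hz]
  rw [logDeriv_apply, logDeriv_apply, h.deriv_eq, h.eq_of_nhds]

theorem hasRegularizedPeriod_thetaUnit {a b : ℚ}
    (hab : ¬((∃ k : ℤ, a = k) ∧ ∃ k : ℤ, b = k)) {α : ℤ} {β : ℕ} (hβ : 0 < β) {c : ℤ}
    (hc : c = 1 ∨ c = -1) (γ : SL(2, ℤ)) (h0 : γ 0 0 = c * α) (h1 : γ 1 0 = c * β) :
    HasRegularizedPeriod
      (fun τ => 1 / (2 * Real.pi * Complex.I) * logDeriv (thetaUnit (coset a b)) τ)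
      ((α : ℚ) / (β : ℚ))
      ((dedekindC α β a b : ℂ) - 1 / (2 * Real.pi * Complex.I) *
        (diracTensorRClog (slash (coset a b) (toRat γ) - coset a b) : ℂ)) := by
  rw [← sum_logTerm hβ a b hc γ h0 h1]
  exact hasRegularizedPeriod_of_eq_logDeriv α hβ hab fun τ hτ => by
    rw [logDeriv_thetaUnit_coset a b hτ]

/-- The first column of `γ` is a multiple `c` of the primitive vector `(α, β)`, and `c` divides the
determinant `1`. -/
theorem exists_sign_of_smul_infty {γ : SL(2, ℤ)} {α : ℤ} {β : ℕ} (hβ : 0 < β)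
    (hαβ : IsCoprime α (β : ℤ))
    (hγ : Matrix.SpecialLinearGroup.mapGL ℚ γ • (∞ : OnePoint ℚ)
      = (((α : ℚ) / (β : ℚ) : ℚ) : OnePoint ℚ)) :
    ∃ c : ℤ, (c = 1 ∨ c = -1) ∧ γ 0 0 = c * α ∧ γ 1 0 = c * β := by
  have hβ' : (β : ℚ) ≠ 0 := by positivity
  have hβz : (β : ℤ) ≠ 0 := by exact_mod_cast hβ.ne'
  have e0 : (Matrix.SpecialLinearGroup.mapGL ℚ γ) 0 0 = (γ 0 0 : ℚ) := by simp
  have e1 : (Matrix.SpecialLinearGroup.mapGL ℚ γ) 1 0 = (γ 1 0 : ℚ) := by simp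
  rw [OnePoint.smul_infty_eq_ite, e0, e1] at hγ
  split_ifs at hγ with h
  · exact absurd hγ (OnePoint.infty_ne_coe _)
  · rw [OnePoint.coe_eq_coe, div_eq_div_iff h hβ'] at hγ
    have hγ' : γ 0 0 * β = α * γ 1 0 := by exact_mod_cast hγ
    obtain ⟨c, hc⟩ : (β : ℤ) ∣ γ 1 0 :=
      hαβ.symm.dvd_of_dvd_mul_left ⟨γ 0 0, by rw [← hγ', mul_comm]⟩
    have h1 : γ 1 0 = c * β := by rw [hc, mul_comm]
    have h0 : γ 0 0 = c * α := by
      refine mul_right_cancel₀ hβz ?_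
      rw [hγ', h1]; ring
    refine ⟨c, ?_, h0, h1⟩
    have hdet := γ.det_coe
    rw [Matrix.det_fin_two, h0, h1] at hdet
    refine Int.isUnit_iff.1 (IsUnit.of_mul_eq_one (α * γ 1 1 - γ 0 1 * β) ?_)
    linear_combination hdet

theorem not_isInt_of_isTestFunction {a b : ℚ} (hf : IsTestFunctionAwayFromZero (coset a b)) :
    ¬((∃ k : ℤ, a = k) ∧ ∃ k : ℤ, b = k) := by
  rintro ⟨⟨k, rfl⟩, l, rfl⟩
  have h := hf.away
  rw [coset, if_pos ⟨⟨-k, by simp⟩, -l, by simp⟩] at h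
  exact one_ne_zero h

theorem toRat_eq (γ : SL(2, ℤ)) :
    toRat γ = !![(γ 0 0 : ℚ), (γ 0 1 : ℚ); (γ 1 0 : ℚ), (γ 1 1 : ℚ)] := by
  ext i j
  fin_cases i <;> fin_cases j <;> rfl

/-- The conjugate of an element of `Γ₀(D)` by `UL(D)`. -/
theorem exists_conj_UL {D : ℕ} (hD : 0 < D) {γ : SL(2, ℤ)} {r : ℤ} (hr : γ 1 0 = D * r) :
    ∃ γD : SL(2, ℤ), toRat γD = UL D * toRat γ * (UL D)⁻¹ ∧ γD 0 0 = γ 0 0 ∧ γD 1 0 = r := by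
  have hD' : (D : ℚ) ≠ 0 := by positivity
  have hdet := γ.det_coe
  rw [Matrix.det_fin_two, hr] at hdet
  refine ⟨⟨!![γ 0 0, D * γ 0 1; r, γ 1 1], ?_⟩, ?_, rfl, rfl⟩
  · rw [Matrix.det_fin_two_of]
    linear_combination hdet
  · have hinv : (UL D)⁻¹ = !![(D : ℚ)⁻¹, 0; 0, 1] := by
      refine Matrix.inv_eq_right_inv ?_
      ext i j
      fin_cases i <;> fin_cases j <;> simp [UL, Matrix.mul_apply, Fin.sum_univ_two, hD']
    have hrq : ((D * r : ℤ) : ℚ) * (D : ℚ)⁻¹ = r := by push_cast; field_simp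
    rw [hinv, toRat_eq γ, UL, hr, Matrix.mul_fin_two, Matrix.mul_fin_two]
    ext i j
    fin_cases i <;> fin_cases j
    · simp [toRat, hD', mul_comm (D : ℚ)]
    · simp [toRat]
    · simpa [toRat] using hrq.symm
    · simp [toRat]

end EisensteinPeriod

end

theorem mainTheorem3 (a b : ℚ)
    (hf : EisensteinPeriod.IsTestFunctionAwayFromZero (EisensteinPeriod.coset a b))
    (γ : SL(2, ℤ)) (α : ℤ) (β : ℕ) (hβ : 0 < β) (hαβ : IsCoprime α (β : ℤ))
    (hγ : Matrix.SpecialLinearGroup.mapGL ℚ γ • (∞ : OnePoint ℚ)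
      = (((α : ℚ) / (β : ℚ) : ℚ) : OnePoint ℚ)) :
    EisensteinPeriod.HasRegularizedPeriod
      (fun τ => 1 / (2 * Real.pi * Complex.I) *
        logDeriv (EisensteinPeriod.thetaUnit (EisensteinPeriod.coset a b)) τ)
      ((α : ℚ) / (β : ℚ))
      ((EisensteinPeriod.dedekindC α β a b : ℂ) -
        1 / (2 * Real.pi * Complex.I) *
          (EisensteinPeriod.diracTensorRClog
            (EisensteinPeriod.slash (EisensteinPeriod.coset a b) (EisensteinPeriod.toRat γ)
              - EisensteinPeriod.coset a b) : ℂ)) ∧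
    ∀ D : ℕ, 0 < D → γ ∈ CongruenceSubgroup.Gamma0 D →
      ∃ γD : SL(2, ℤ),
        EisensteinPeriod.toRat γD
          = EisensteinPeriod.UL D * EisensteinPeriod.toRat γ * (EisensteinPeriod.UL D)⁻¹ ∧
        EisensteinPeriod.HasRegularizedPeriod
          (fun τ => 1 / (2 * Real.pi * Complex.I) *
            logDeriv (fun z => EisensteinPeriod.thetaUnit (EisensteinPeriod.coset a b) (D * z)) τ)
          ((α : ℚ) / (β : ℚ))
          ((EisensteinPeriod.dedekindC α (β / D) a b : ℂ) -
            1 / (2 * Real.pi * Complex.I) *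
              (EisensteinPeriod.diracTensorRClog
                (EisensteinPeriod.slash (EisensteinPeriod.coset a b) (EisensteinPeriod.toRat γD)
                  - EisensteinPeriod.coset a b) : ℂ)) := by
  have hab := EisensteinPeriod.not_isInt_of_isTestFunction hf
  obtain ⟨c, hc, h0, h1⟩ := EisensteinPeriod.exists_sign_of_smul_infty hβ hαβ hγ
  refine ⟨EisensteinPeriod.hasRegularizedPeriod_thetaUnit hab hβ hc γ h0 h1, fun D hD hγD => ?_⟩
  obtain ⟨r, hr⟩ : (D : ℤ) ∣ γ 1 0 :=
    (ZMod.intCast_zmod_eq_zero_iff_dvd _ _).1 (CongruenceSubgroup.Gamma0_mem.1 hγD)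
  obtain ⟨γD, hγD1, h0', h1'⟩ := EisensteinPeriod.exists_conj_UL hD hr
  refine ⟨γD, hγD1, ?_⟩
  have hcc : c * c = 1 := by rcases hc with rfl | rfl <;> norm_num
  -- Up to the sign `c`, `β` is the lower left entry of `γ`, so `D` divides it and `β / D` is an
  -- exact quotient.
  have hβD : (β : ℤ) = D * (c * r) := by
    calc (β : ℤ) = c * c * β := by rw [hcc, one_mul]
      _ = c * (γ 1 0) := by rw [h1, mul_assoc]
      _ = D * (c * r) := by rw [hr]; ring
  obtain ⟨β', rfl⟩ : D ∣ β := Int.natCast_dvd_natCast.1 ⟨_, hβD⟩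
  have hβ' : 0 < β' := Nat.pos_of_mul_pos_left hβ
  have hDz : (D : ℤ) ≠ 0 := by exact_mod_cast hD.ne'
  have hcr : (β' : ℤ) = c * r := mul_left_cancel₀ hDz (by rw [← hβD]; push_cast; rfl)
  have hr' : r = c * β' := by rw [hcr, ← mul_assoc, hcc, one_mul]
  rw [Nat.mul_div_cancel_left _ hD]
  have key := EisensteinPeriod.hasRegularizedPeriod_thetaUnit hab hβ' hc γD (h0'.trans h0)
    (h1'.trans hr')
  have hD' : (D : ℚ) ≠ 0 := by positivity
  have hβq : (β' : ℚ) ≠ 0 := by positivity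
  -- The cusp of `γD` is `D` times that of `γ`, as the rescaling lemma requires.
  have hcusp : (α : ℚ) / (β' : ℚ) = D * ((α : ℚ) / ((D * β' : ℕ) : ℚ)) := by
    push_cast
    field_simp
  rw [hcusp] at key
  have := key.comp_mul_left hD
  convert this using 2 with τ
  rw [EisensteinPeriod.logDeriv_comp_mul_left]
  ring
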